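/- Let $\Lambda$ be a weakly finite (i.e. stably finite) ring with $1$ and with an involution $x\mapsto\bar x$; modules are left modules, and $M^*=\mathrm{Hom}_\Lambda(M,\Lambda)$ is a left module via $(a f)(x)=f(x)\bar a$. Let $q\ge 0$ and $\epsilon=(-1)^q$. **Definitions.** For $\eta=\pm1$ let $Q_\eta(M)=\mathrm{coker}\bigl(1-T_\eta\colon \mathrm{Hom}_\Lambda(M,M^*)\to \mathrm{Hom}_\Lambda(M,M^*)\bigr)$, $T_\eta\phi=\eta\phi^*$. An $\eta$-quadratic form $(M,\psi)$ is a f.g. free module $M$ with $\psi\in Q_\eta(M)$; it is non-singular if $\psi+\eta\psi^*\colon M\to M^*$ is an isomorphism. A lagrangian of $(M,\psi)$ is a direct summand $j\colon L\hookrightarrow M$ with $j^*\psi j=0\in Q_\eta(L)$ and $L=\ker(j^*(\psi+\eta\psi^*))$. For $P$ f.g. free, $H_\eta(P)=\bigl(P\oplus P^*,\begin{pmatrix}0&1\\0&0\end{pmatrix}\bigr)$. $L_{2q+2}(\Lambda)$ is the group of non-singular $(-\epsilon)$-quadratic forms up to isometry after adding hyperbolic forms $H_{-\epsilon}(P)$.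 A regular $\epsilon$-quadratic split preformation $z=(F\xleftarrow{\gamma}G\xrightarrow{\mu}F^*,\theta)$ consists of f.g. free modules $F,G$, homomorphisms $\gamma,\mu$ and $\theta\in Q_{-\epsilon}(G)$ with $\theta-\epsilon\theta^*=\gamma^*\mu$. It is a non-singular formation if $\binom{\gamma}{\mu}\colon G\to F\oplus F^*$ is injective with image a lagrangian of $H_\epsilon(F)$. A strong isomorphism $z\cong z'$ is a pair of isomorphisms $\alpha\colon F\to F'$, $\beta\colon G\to G'$ with $\alpha\gamma=\gamma'\beta$, $\alpha^{-*}\mu=\mu'\beta$, $\theta=\beta^*\theta'\beta$. The boundary of a $(-\epsilon)$-quadratic form $(K,\theta)$ is $\partial(K,\theta)=(K\xleftarrow{1}K\xrightarrow{\theta-\epsilon\theta^*}K^*,\theta)$. The monoid $l_{2q+2}(\Lambda)$ consists of the regular preformations up to strong isomorphism after adding boundaries $\partial H_{-\epsilon}(P)$, $P$ f.g. free. $z$ is elementary if there is a f.g. free submodule $j\colon U\hookrightarrow G$ with $j^*\gamma^*\mu j=0$ and $j^*\theta j=0\in Q_{-\epsilon}(U)$ such that $\gamma j$, $\mu j$ are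 injective, their images $U_0\subseteq F$, $U_1\subseteq F^*$ are direct summands, and $F^*/U_1\to U_0^*$, $f\mapsto f|_{U_0}$, is an isomorphism. An element of $l_{2q+2}(\Lambda)$ is elementary if it has an elementary representative. A flip-isomorphism of $z$ is a triple $t=(\alpha,\beta,\nu)$ of isomorphisms $\alpha\colon F\to F^*$, $\beta\colon G\to G$ and $\nu\in Q_{-\epsilon}(F^*)$ with $\alpha\gamma+\alpha(\nu-\epsilon\nu^*)^*\mu=\epsilon\mu\beta$, $\alpha^{-*}\mu=\gamma\beta$ and $\theta+\mu^*\nu\mu+\beta^*\theta\beta=0\in Q_{-\epsilon}(G)$; it is strong if $\nu=0$. A stable (strong) flip-isomorphism of $z$ is a (strong) flip-isomorphism of $z+\partial H_{-\epsilon}(P)$ for some f.g. free $P$. $LAsy^0(\Lambda)$ is the Witt group of non-singular asymmetric forms $(M,\lambda\colon M\xrightarrow{\cong}M^*)$, $M$ f.g. free, up to isometry after adding non-singular metabolic forms, i.e. forms having a direct summand $L$ with $L=L^\perp=\{x\in M:\lambda(x)(L)=0\}$. The asymmetric signature $\sigma^*(z,t)\in LAsy^0(\Lambda)$ is the class of $$\begin{pmatrix}0&0&\alpha\\1&0&-\epsilon\\0&1&\epsilon\alpha(\nu^*-\epsilon\nu)\alpha^*\end{pmatrix}\colon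 F\oplus F^*\oplus F\to (F\oplus F^*\oplus F)^*;$$ for a stable flip-isomorphism it is that of the flip-isomorphism of $z+\partial H_{-\epsilon}(P)$. **Statement.** Let $(K,\theta)$ be a $(-\epsilon)$-quadratic form on a f.g. free $\Lambda$-module, and $z=\partial(K,\theta)$. Then $z$ is a non-singular formation, and: 1. $z$ has a flip-isomorphism if and only if $(K,\theta)$ is non-singular, and $z$ has a stable flip-isomorphism if and only if $(K,\theta)$ is non-singular. 2. $z$ has a stable strong flip-isomorphism if and only if $(K,\theta)$ is non-singular and $2\cdot[(K,\theta)]=0\in L_{2q+2}(\Lambda)$. 3. $[z]\in l_{2q+2}(\Lambda)$ is elementary if and only if $(K,\theta)$ is non-singular and $[(K,\theta)]=0\in L_{2q+2}(\Lambda)$. 4. If $(K,\theta)$ is non-singular, the asymmetric signature of every flip-isomorphism and of every stable flip-isomorphism of $z$ equals $[(K,\theta-\epsilon\theta^*)]\in LAsy^0(\Lambda)$. 5. Suppose that $\Lambda$ is a field of characteristic different from $2$, or that $\Lambda=\mathbb Z$ and $\epsilon=-1$. Then $z$ is elementary if and only if the asymmetric signature of $z$ vanishes, that is, $z$ has stable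 flip-isomorphisms and all their asymmetric signatures are $0\in LAsy^0(\Lambda)$. The same condition is equivalent to $[z]\in l_{2q+2}(\Lambda)$ being elementary. -/

import Mathlib

universe u

set_option linter.unusedSectionVars false

noncomputable section

namespace LTheory

/-! ## Duals of left modules over a ring with involution

A ring with involution is a ring `Λ` with `[StarRing Λ]`; `star a` is the conjugate of `a`. -/

section Dual

variable (Λ : Type u) [Ring Λ] [StarRing Λ]

/-- The dual `M* = Hom_Λ(M, Λ)` of a left `Λ`-module. -/
def Dual (M : Type u) [AddCommGroup M] [Module Λ M] : Type u := M →ₗ[Λ] Λ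

variable (M : Type u) [AddCommGroup M] [Module Λ M]

instance : AddCommGroup (Dual Λ M) := inferInstanceAs (AddCommGroup (M →ₗ[Λ] Λ))
instance : FunLike (Dual Λ M) M Λ := inferInstanceAs (FunLike (M →ₗ[Λ] Λ) M Λ)
instance : LinearMapClass (Dual Λ M) Λ M Λ :=
  inferInstanceAs (LinearMapClass (M →ₗ[Λ] Λ) Λ M Λ)

variable {Λ M}

/-- A linear functional, regarded as an element of the dual. -/
def Dual.of (f : M →ₗ[Λ] Λ) : Dual Λ M := f

@[simp] theorem Dual.of_apply (f : M →ₗ[Λ] Λ) (x : M) : Dual.of f x = f x := rfl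
@[ext] theorem Dual.ext {f g : Dual Λ M} (h : ∀ x, f x = g x) : f = g :=
  LinearMap.ext (f := f) (g := g) h
@[simp] theorem Dual.add_apply (f g : Dual Λ M) (x : M) : (f + g) x = f x + g x := rfl
@[simp] theorem Dual.zero_apply (x : M) : (0 : Dual Λ M) x = 0 := rfl
@[simp] theorem Dual.neg_apply (f : Dual Λ M) (x : M) : (-f) x = -f x := rfl
@[simp] theorem Dual.sub_apply (f g : Dual Λ M) (x : M) : (f - g) x = f x - g x := rfl

theorem Dual.sum_apply {ι : Type*} (s : Finset ι) (f : ι → Dual Λ M) (x : M) :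
    (∑ i ∈ s, f i) x = ∑ i ∈ s, f i x := LinearMap.sum_apply s f x

/-- The involution turns `M*` into a left module: `(a • f) x = f x * star a`. -/
instance : Module Λ (Dual Λ M) where
  smul a f := Dual.of
    { toFun := fun x => f x * star a
      map_add' := fun x y => by rw [map_add, add_mul]
      map_smul' := fun b x => by simp [mul_assoc] }
  one_smul f := Dual.ext fun x => show f x * star 1 = f x by simp
  mul_smul a b f := Dual.ext fun x => show f x * star (a * b) = f x * star b * star a by
    simp [mul_assoc]
  smul_zero a := Dual.ext fun x => show (0 : Λ) * star a = 0 by simp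
  smul_add a f g := Dual.ext fun x =>
    show (f x + g x) * star a = f x * star a + g x * star a by rw [add_mul]
  add_smul a b f := Dual.ext fun x =>
    show f x * star (a + b) = f x * star a + f x * star b by rw [star_add, mul_add]
  zero_smul f := Dual.ext fun x => show f x * star 0 = 0 by simp

@[simp] theorem Dual.smul_apply (a : Λ) (f : Dual Λ M) (x : M) : (a • f) x = f x * star a := rfl

/-- The canonical map `M → M**`, `x ↦ (f ↦ star (f x))`. -/
def ev : M →ₗ[Λ] Dual Λ (Dual Λ M) where
  toFun x := Dual.of
    { toFun := fun f => star (f x)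
      map_add' := fun f g => by simp
      map_smul' := fun a f => by simp }
  map_add' x y := Dual.ext fun f => by simp
  map_smul' a x := Dual.ext fun f => by simp

@[simp] theorem ev_apply (x : M) (f : Dual Λ M) : ev x f = star (f x) := rfl

variable {N : Type u} [AddCommGroup N] [Module Λ N]

/-- The dual `φ* : N* → M*` of `φ : M → N`. -/
def dualMap (φ : M →ₗ[Λ] N) : Dual Λ N →ₗ[Λ] Dual Λ M where
  toFun f := Dual.of (LinearMap.comp f φ)
  map_add' _ _ := rfl
  map_smul' _ _ := rfl

@[simp] theorem dualMap_apply (φ : M →ₗ[Λ] N) (f : Dual Λ N) (x : M) :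
    dualMap φ f x = f (φ x) := rfl

/-- The isomorphism `α^{-*} = (α⁻¹)* : M* → N*` given by an isomorphism `α : M → N`. -/
def invDual (α : M ≃ₗ[Λ] N) : Dual Λ M ≃ₗ[Λ] Dual Λ N :=
  LinearEquiv.ofLinearMap (dualMap α.symm.toLinearMap) (dualMap α.toLinearMap)
    (by ext f x; simp) (by ext f x; simp)

@[simp] theorem invDual_apply (α : M ≃ₗ[Λ] N) (f : Dual Λ M) (x : N) :
    invDual α f x = f (α.symm x) := rfl

/-- `φ : M → N*` gives the adjoint `φ* : N → M*`, `φ*(y)(x) = star (φ(x)(y))`. -/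
def adj : (M →ₗ[Λ] Dual Λ N) →+ (N →ₗ[Λ] Dual Λ M) where
  toFun φ :=
    { toFun := fun y => Dual.of
        { toFun := fun x => star (φ x y)
          map_add' := fun x x' => by simp
          map_smul' := fun a x => by simp }
      map_add' := fun y y' => Dual.ext fun x => by simp
      map_smul' := fun a y => Dual.ext fun x => by simp }
  map_zero' := by ext y x; simp
  map_add' φ ψ := by ext y x; simp

@[simp] theorem adj_apply (φ : M →ₗ[Λ] Dual Λ N) (x : M) (y : N) :
    adj φ y x = star (φ x y) := rfl

/-- A finite basis of `M` identifies `M*` with a free module of the same rank. -/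
def dualBasisEquiv {ι : Type*} [Fintype ι] (b : Module.Basis ι Λ M) :
    Dual Λ M ≃ₗ[Λ] (ι → Λ) where
  toFun f i := star (f (b i))
  map_add' f g := by ext i; simp
  map_smul' a f := by ext i; simp
  invFun c := Dual.of ((Fintype.linearCombination Λ (fun i => star (c i))) ∘ₗ
    b.equivFun.toLinearMap)
  left_inv f := Dual.ext fun x => by
    have h := congrArg f (b.sum_equivFun x)
    simp only [map_sum, map_smul] at h
    simpa [Fintype.linearCombination_apply] using h
  right_inv c := by
    classical
    ext i
    simp [Fintype.linearCombination_apply, Finsupp.single_apply]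

instance [Module.Free Λ M] [Module.Finite Λ M] : Module.Free Λ (Dual Λ M) :=
  Module.Free.of_equiv (dualBasisEquiv (Module.Free.chooseBasis Λ M)).symm

instance [Module.Free Λ M] [Module.Finite Λ M] : Module.Finite Λ (Dual Λ M) :=
  Module.Finite.equiv (dualBasisEquiv (Module.Free.chooseBasis Λ M)).symm

theorem ev_bijective [Module.Free Λ M] [Module.Finite Λ M] :
    Function.Bijective (ev : M →ₗ[Λ] Dual Λ (Dual Λ M)) := by
  classical
  let b := Module.Free.chooseBasis Λ M
  constructor
  · rw [injective_iff_map_eq_zero]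
    intro x hx
    refine b.ext_elem fun i => ?_
    have h : ev x (Dual.of (b.coord i)) = 0 := by rw [hx]; rfl
    simpa using h
  · intro F
    refine ⟨∑ i, star (F (Dual.of (b.coord i))) • b i, Dual.ext fun g => ?_⟩
    have hg : g = ∑ i, star (g (b i)) • Dual.of (b.coord i) := by
      apply (dualBasisEquiv b).injective
      ext j
      simp [dualBasisEquiv, Finset.sum_apply, Finsupp.single_apply, apply_ite star]
    conv_rhs => rw [hg]
    simp [map_sum, Dual.sum_apply]

/-- The identification `M ≅ M**` for a finitely generated free module. -/
def evEquiv [Module.Free Λ M] [Module.Finite Λ M] : M ≃ₗ[Λ] Dual Λ (Dual Λ M) :=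
  LinearEquiv.ofBijective ev ev_bijective

variable {M' N' : Type u} [AddCommGroup M'] [Module Λ M'] [AddCommGroup N'] [Module Λ N']

/-- The direct sum `M ⊕ M' → N* ⊕ N'* = (N ⊕ N')*` of two maps. -/
def dualSum (φ : M →ₗ[Λ] Dual Λ N) (φ' : M' →ₗ[Λ] Dual Λ N') :
    M × M' →ₗ[Λ] Dual Λ (N × N') :=
  dualMap (LinearMap.fst Λ N N') ∘ₗ φ ∘ₗ LinearMap.fst Λ M M' +
    dualMap (LinearMap.snd Λ N N') ∘ₗ φ' ∘ₗ LinearMap.snd Λ M M'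

@[simp] theorem dualSum_apply (φ : M →ₗ[Λ] Dual Λ N) (φ' : M' →ₗ[Λ] Dual Λ N')
    (x : M × M') (y : N × N') : dualSum φ φ' x y = φ x.1 y.1 + φ' x.2 y.2 := rfl

/-- The identification `M* ⊕ N* = (M ⊕ N)*`. -/
def dualProd : (Dual Λ M × Dual Λ N) ≃ₗ[Λ] Dual Λ (M × N) :=
  LinearEquiv.ofLinearMap (dualSum LinearMap.id LinearMap.id)
    ((dualMap (LinearMap.inl Λ M N)).prod (dualMap (LinearMap.inr Λ M N)))
    (by
      ext f x
      have h := map_add f (x.1, 0) (0, x.2)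
      simp only [Prod.mk_add_mk, add_zero, zero_add] at h
      simpa using h.symm)
    (by
      apply LinearMap.ext
      rintro ⟨f, g⟩
      ext x <;> simp)

@[simp] theorem dualProd_apply (f : Dual Λ M × Dual Λ N) (x : M × N) :
    dualProd f x = f.1 x.1 + f.2 x.2 := rfl

theorem dualSum_bijective {φ : M →ₗ[Λ] Dual Λ N} {φ' : M' →ₗ[Λ] Dual Λ N'}
    (h : Function.Bijective φ) (h' : Function.Bijective φ') :
    Function.Bijective (dualSum φ φ') := by
  have : ⇑(dualSum φ φ') = dualProd ∘ Prod.map φ φ' := rfl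
  rw [this]
  exact dualProd.bijective.comp (h.prodMap h')

end Dual

/-! ## The groups `Q_ε(M)` -/

section Q

variable {Λ : Type u} [Ring Λ] [StarRing Λ]
variable {M N : Type u} [AddCommGroup M] [Module Λ M] [AddCommGroup N] [Module Λ N]

/-- The duality involution `T_ε φ = ε φ*` on `Hom_Λ(M, M*)`. -/
def T (ε : ℤˣ) : (M →ₗ[Λ] Dual Λ M) →+ (M →ₗ[Λ] Dual Λ M) := (ε : ℤ) • adj

theorem adj_adj (φ : M →ₗ[Λ] Dual Λ N) : adj (adj φ) = φ := by ext x y; simp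

theorem T_T (ε : ℤˣ) (φ : M →ₗ[Λ] Dual Λ M) : T ε (T ε φ) = φ := by
  rcases Int.units_eq_one_or ε with rfl | rfl <;> simp [T, adj_adj]

variable (Λ) in
/-- `Q_ε(M) = coker (1 - T_ε : Hom_Λ(M, M*) → Hom_Λ(M, M*))`. -/
abbrev Q (ε : ℤˣ) (M : Type u) [AddCommGroup M] [Module Λ M] : Type u :=
  (M →ₗ[Λ] Dual Λ M) ⧸ (AddMonoidHom.id (M →ₗ[Λ] Dual Λ M) - T ε).range

/-- The class in `Q_ε(M)` of `φ : M → M*`. -/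
def Q.mk (ε : ℤˣ) (φ : M →ₗ[Λ] Dual Λ M) : Q Λ ε M := QuotientAddGroup.mk φ

theorem Q.mk_add (ε : ℤˣ) (φ ψ : M →ₗ[Λ] Dual Λ M) : Q.mk ε (φ + ψ) = Q.mk ε φ + Q.mk ε ψ := rfl

theorem Q.mk_sub_T (ε : ℤˣ) (φ : M →ₗ[Λ] Dual Λ M) : Q.mk ε (φ - T ε φ) = 0 :=
  (QuotientAddGroup.eq_zero_iff _).2 ⟨φ, rfl⟩

theorem Q.exists_mk {ε : ℤˣ} (θ : Q Λ ε M) : ∃ φ, Q.mk ε φ = θ :=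
  QuotientAddGroup.mk_surjective θ

theorem Q.eq_of_subsingleton [Subsingleton M] {ε : ℤˣ} (θ θ' : Q Λ ε M) : θ = θ' := by
  obtain ⟨φ, rfl⟩ := Q.exists_mk θ
  obtain ⟨φ', rfl⟩ := Q.exists_mk θ'
  congr 1
  ext x
  rw [Subsingleton.elim x 0, map_zero, map_zero]

/-- The symmetrization `1 + T_ε : Q_ε(M) → Hom_Λ(M, M*)`, `[ψ] ↦ ψ + ε ψ*`. -/
def symmetrize (ε : ℤˣ) : Q Λ ε M →+ (M →ₗ[Λ] Dual Λ M) :=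
  QuotientAddGroup.lift _ (AddMonoidHom.id _ + T ε) (by
    rintro _ ⟨φ, rfl⟩
    simp [T_T])

@[simp] theorem symmetrize_mk (ε : ℤˣ) (φ : M →ₗ[Λ] Dual Λ M) :
    symmetrize ε (Q.mk ε φ) = φ + T ε φ := rfl

/-- `φ ↦ f* φ f`. -/
def pullHom (f : M →ₗ[Λ] N) : (N →ₗ[Λ] Dual Λ N) →+ (M →ₗ[Λ] Dual Λ M) where
  toFun φ := dualMap f ∘ₗ φ ∘ₗ f
  map_zero' := rfl
  map_add' _ _ := rfl

@[simp] theorem pullHom_apply (f : M →ₗ[Λ] N) (φ : N →ₗ[Λ] Dual Λ N) (x y : M) :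
    pullHom f φ x y = φ (f x) (f y) := rfl

theorem pullHom_T (f : M →ₗ[Λ] N) (ε : ℤˣ) (φ : N →ₗ[Λ] Dual Λ N) :
    pullHom f (T ε φ) = T ε (pullHom f φ) := by
  rcases Int.units_eq_one_or ε with rfl | rfl <;> (ext x y; simp [T])

/-- The pullback `f* : Q_ε(N) → Q_ε(M)`, `[ψ] ↦ [f* ψ f]`, along `f : M → N`. -/
def pull {ε : ℤˣ} (f : M →ₗ[Λ] N) : Q Λ ε N →+ Q Λ ε M :=
  QuotientAddGroup.map _ _ (pullHom f) (by
    rintro _ ⟨φ, rfl⟩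
    exact ⟨pullHom f φ, by simp [pullHom_T]⟩)

@[simp] theorem pull_mk {ε : ℤˣ} (f : M →ₗ[Λ] N) (φ : N →ₗ[Λ] Dual Λ N) :
    pull f (Q.mk ε φ) = Q.mk ε (pullHom f φ) :=
  rfl

variable {R : Type u} [AddCommGroup R] [Module Λ R]

theorem pull_pull {ε : ℤˣ} (f : M →ₗ[Λ] N) (g : N →ₗ[Λ] R) (θ : Q Λ ε R) :
    pull f (pull g θ) = pull (g ∘ₗ f) θ := by
  obtain ⟨φ, rfl⟩ := Q.exists_mk θ
  rfl

theorem pull_id {ε : ℤˣ} (θ : Q Λ ε M) : pull LinearMap.id θ = θ := by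
  obtain ⟨φ, rfl⟩ := Q.exists_mk θ
  rfl

theorem symmetrize_pull {ε : ℤˣ} (f : M →ₗ[Λ] N) (θ : Q Λ ε N) :
    symmetrize ε (pull f θ) = pullHom f (symmetrize ε θ) := by
  obtain ⟨φ, rfl⟩ := Q.exists_mk θ
  simp [pullHom_T]

/-- The direct sum `θ ⊕ θ'` in `Q_ε(M ⊕ N)`. -/
def qSum {ε : ℤˣ} (θ : Q Λ ε M) (θ' : Q Λ ε N) : Q Λ ε (M × N) :=
  pull (LinearMap.fst Λ M N) θ + pull (LinearMap.snd Λ M N) θ'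

theorem pull_qSum {ε : ℤˣ} (f : R →ₗ[Λ] M × N) (θ : Q Λ ε M) (θ' : Q Λ ε N) :
    pull f (qSum θ θ') =
      pull (LinearMap.fst Λ M N ∘ₗ f) θ + pull (LinearMap.snd Λ M N ∘ₗ f) θ' := by
  rw [qSum, map_add, pull_pull, pull_pull]

theorem symmetrize_qSum {ε : ℤˣ} (θ : Q Λ ε M) (θ' : Q Λ ε N) :
    symmetrize ε (qSum θ θ') = dualSum (symmetrize ε θ) (symmetrize ε θ') := by
  rw [qSum, map_add, symmetrize_pull, symmetrize_pull]
  rfl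

end Q

/-! ## Quadratic forms and the even-dimensional quadratic `L`-groups -/

section Stable

/-- The congruence `x ~ y ↔ x + s = y + t` for some `s`, `t` in a given submonoid. -/
def stableCon {A : Type*} [AddCommMonoid A] (S : AddSubmonoid A) : AddCon A where
  r x y := ∃ s ∈ S, ∃ t ∈ S, x + s = y + t
  iseqv :=
    { refl := fun x => ⟨0, S.zero_mem, 0, S.zero_mem, rfl⟩
      symm := fun ⟨s, hs, t, ht, h⟩ => ⟨t, ht, s, hs, h.symm⟩
      trans := by
        rintro x y z ⟨s, hs, t, ht, h⟩ ⟨s', hs', t', ht', h'⟩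
        refine ⟨s + s', S.add_mem hs hs', t' + t, S.add_mem ht' ht, ?_⟩
        rw [← add_assoc, h, add_right_comm, h', add_assoc] }
  add' := by
    rintro w x y z ⟨s, hs, t, ht, h⟩ ⟨s', hs', t', ht', h'⟩
    exact ⟨s + s', S.add_mem hs hs', t + t', S.add_mem ht ht',
      by rw [add_add_add_comm, h, h', add_add_add_comm]⟩

/-- A commutative monoid in which every element has a negative is an abelian group. -/
abbrev groupOfExistsNeg {A : Type*} [AddCommMonoid A] (h : ∀ x : A, ∃ y, y + x = 0) :
    AddCommGroup A :=
  letI : Neg A := ⟨fun x => (h x).choose⟩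
  { (inferInstance : AddCommMonoid A) with
    neg_add_cancel := fun x => (h x).choose_spec
    zsmul := zsmulRec }

end Stable

section Forms

variable (Λ : Type u) [Ring Λ] [StarRing Λ]

/-- An `ε`-quadratic form `(K, θ)`, `θ ∈ Q_ε(K)`, on a finitely generated free `Λ`-module `K`. -/
structure QForm (ε : ℤˣ) where
  K : Type u
  [addCommGroup : AddCommGroup K]
  [module : Module Λ K]
  [free : Module.Free Λ K]
  [finite : Module.Finite Λ K]
  form : Q Λ ε K

attribute [instance] QForm.addCommGroup QForm.module QForm.free QForm.finite

variable {Λ} {ε : ℤˣ}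

namespace QForm

/-- The underlying `ε`-symmetric form `θ + ε θ* : K → K*`. -/
def bilin (X : QForm Λ ε) : X.K →ₗ[Λ] Dual Λ X.K := symmetrize ε X.form

/-- `(K, θ)` is non-singular if `θ + ε θ* : K → K*` is an isomorphism. -/
def Nonsingular (X : QForm Λ ε) : Prop := Function.Bijective X.bilin

/-- A lagrangian: a direct summand `j : L → K` with `j* θ j = 0 ∈ Q_ε(L)` and `L = L^⊥`, where
`L^⊥ = ker (j* (θ + ε θ*) : K → L*)`. -/
def IsLagrangian (X : QForm Λ ε) (L : Submodule Λ X.K) : Prop :=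
  (∃ C : Submodule Λ X.K, IsCompl L C) ∧ pull L.subtype X.form = 0 ∧
    L = LinearMap.ker (dualMap L.subtype ∘ₗ X.bilin)

/-- An isometry is an isomorphism `f : K → K'` with `f* θ' f = θ ∈ Q_ε(K)`. -/
def Isometric (X Y : QForm Λ ε) : Prop :=
  ∃ f : X.K ≃ₗ[Λ] Y.K, pull f.toLinearMap Y.form = X.form

/-- The direct sum of two forms. -/
def sum (X Y : QForm Λ ε) : QForm Λ ε := ⟨X.K × Y.K, qSum X.form Y.form⟩

variable (Λ ε) in
/-- The form on the zero module. -/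
def trivial : QForm Λ ε := ⟨PUnit, 0⟩

variable (Λ ε) in
/-- The hyperbolic form `H_ε(P) = (P ⊕ P*, (0 1; 0 0))`. -/
def hyperbolic (P : Type u) [AddCommGroup P] [Module Λ P] [Module.Free Λ P]
    [Module.Finite Λ P] : QForm Λ ε :=
  ⟨P × Dual Λ P, Q.mk ε
    (dualMap (LinearMap.fst Λ P (Dual Λ P)) ∘ₗ LinearMap.snd Λ P (Dual Λ P))⟩

theorem Isometric.refl (X : QForm Λ ε) : Isometric X X := ⟨LinearEquiv.refl Λ _, pull_id _⟩

theorem Isometric.symm {X Y : QForm Λ ε} : Isometric X Y → Isometric Y X := by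
  rintro ⟨f, hf⟩
  refine ⟨f.symm, ?_⟩
  rw [← hf, pull_pull]
  convert pull_id Y.form using 2
  ext x
  simp

theorem Isometric.trans {X Y Z : QForm Λ ε} :
    Isometric X Y → Isometric Y Z → Isometric X Z := by
  rintro ⟨f, hf⟩ ⟨g, hg⟩
  refine ⟨f.trans g, ?_⟩
  rw [← hf, ← hg, pull_pull]
  rfl

variable (Λ ε) in
/-- Isometry of quadratic forms, as an equivalence relation. -/
def setoid : Setoid (QForm Λ ε) :=
  ⟨Isometric, Isometric.refl, Isometric.symm, Isometric.trans⟩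

theorem sum_congr {X X' Y Y' : QForm Λ ε} :
    Isometric X X' → Isometric Y Y' → Isometric (X.sum Y) (X'.sum Y') := by
  rintro ⟨f, hf⟩ ⟨g, hg⟩
  refine ⟨f.prodCongr g, ?_⟩
  refine (pull_qSum _ _ _).trans ?_
  change _ = qSum X.form Y.form
  rw [← hf, ← hg, qSum, pull_pull, pull_pull]
  rfl

theorem sum_comm (X Y : QForm Λ ε) : Isometric (X.sum Y) (Y.sum X) := by
  refine ⟨LinearEquiv.prodComm Λ _ _, ?_⟩
  refine (pull_qSum _ _ _).trans ?_
  rw [add_comm]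
  rfl

theorem sum_assoc (X Y Z : QForm Λ ε) :
    Isometric ((X.sum Y).sum Z) (X.sum (Y.sum Z)) := by
  refine ⟨LinearEquiv.prodAssoc Λ _ _ _, ?_⟩
  refine (pull_qSum _ _ _).trans ((congrArg _ (pull_qSum _ _ _)).trans ?_)
  change _ = qSum (qSum X.form Y.form) Z.form
  rw [qSum, qSum, map_add, pull_pull, pull_pull, add_assoc]
  rfl

theorem trivial_sum (X : QForm Λ ε) : Isometric ((trivial Λ ε).sum X) X := by
  refine ⟨LinearEquiv.uniqueProd (M₂ := PUnit.{u + 1}), ?_⟩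
  change _ = qSum (0 : Q Λ ε PUnit) X.form
  rw [qSum, map_zero, zero_add]
  rfl

theorem hyperbolic_sum (P P' : Type u) [AddCommGroup P] [Module Λ P] [Module.Free Λ P]
    [Module.Finite Λ P] [AddCommGroup P'] [Module Λ P'] [Module.Free Λ P']
    [Module.Finite Λ P'] :
    Isometric ((hyperbolic Λ ε P).sum (hyperbolic Λ ε P')) (hyperbolic Λ ε (P × P')) := by
  refine ⟨(LinearEquiv.prodProdProdComm Λ P (Dual Λ P) P' (Dual Λ P')).trans
    ((LinearEquiv.refl Λ (P × P')).prodCongr dualProd), ?_⟩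
  refine congrArg (Q.mk ε (M := (P × Dual Λ P) × (P' × Dual Λ P'))) ?_
  rfl

theorem trivial_isometric_hyperbolic :
    Isometric (trivial Λ ε) (hyperbolic Λ ε PUnit) := by
  have : Subsingleton (PUnit.{u + 1} × Dual Λ PUnit.{u + 1}) :=
    ⟨fun f g => Prod.ext rfl (Dual.ext fun x => by
      rw [Subsingleton.elim x 0, map_zero, map_zero])⟩
  let e : PUnit.{u + 1} ≃ₗ[Λ] PUnit.{u + 1} × Dual Λ PUnit.{u + 1} :=
    LinearEquiv.ofBijective 0 ⟨fun _ _ _ => rfl, fun y => ⟨0, Subsingleton.elim _ _⟩⟩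
  exact ⟨e, Q.eq_of_subsingleton (M := PUnit) _ _⟩

theorem Nonsingular.sum {X Y : QForm Λ ε} (hX : X.Nonsingular) (hY : Y.Nonsingular) :
    (X.sum Y).Nonsingular := by
  have h : (X.sum Y).bilin = dualSum X.bilin Y.bilin := symmetrize_qSum _ _
  rw [Nonsingular, h]
  exact dualSum_bijective hX hY

theorem trivial_nonsingular : (trivial Λ ε).Nonsingular := by
  refine ⟨fun _ _ _ => rfl, fun f => ⟨(0 : PUnit), Dual.ext fun x => ?_⟩⟩
  have hx : x = 0 := Subsingleton.elim (α := PUnit) x 0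
  rw [hx, map_zero, map_zero]

/-- The form `(K, -θ)`. -/
def neg (X : QForm Λ ε) : QForm Λ ε := ⟨X.K, -X.form⟩

theorem Nonsingular.neg {X : QForm Λ ε} (hX : X.Nonsingular) : X.neg.Nonsingular := by
  have h : ⇑X.neg.bilin = Neg.neg ∘ ⇑X.bilin := by
    funext x
    exact congrArg (fun φ : X.K →ₗ[Λ] Dual Λ X.K => φ x) (map_neg (symmetrize ε) X.form)
  rw [Nonsingular, h]
  exact neg_involutive.bijective.comp hX

/-- If `(K, θ)` is non-singular then `(K, θ) ⊕ (K, -θ)` is isometric to `H_ε(K)`. -/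
theorem hyperbolic_isometric_sum_neg (X : QForm Λ ε) (hX : X.Nonsingular) :
    Isometric (hyperbolic Λ ε X.K) (X.sum X.neg) := by
  obtain ⟨ψ, hψ⟩ := Q.exists_mk X.form
  have hε : (ε : ℤ) * ε = 1 := by
    rw [← Units.val_mul, Int.units_mul_self, Units.val_one]
  have hbil : ∀ x y, X.bilin x y = ψ x y + (ε : ℤ) • star (ψ y x) := by
    intro x y
    have : X.bilin = ψ + T ε ψ := by rw [bilin, ← hψ, symmetrize_mk]
    rw [this]
    rcases Int.units_eq_one_or ε with rfl | rfl <;> simp [T]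
  let lam : X.K ≃ₗ[Λ] Dual Λ X.K := LinearEquiv.ofBijective X.bilin hX
  let d : Dual Λ X.K →ₗ[Λ] X.K := lam.symm.toLinearMap
  have hd : ∀ f, X.bilin (d f) = f := fun f => lam.apply_symm_apply f
  have hsw : ∀ f g : Dual Λ X.K, f (d g) = (ε : ℤ) • star (g (d f)) := by
    intro f g
    have h1 : f (d g) = X.bilin (d f) (d g) := by rw [hd]
    have h2 : g (d f) = X.bilin (d g) (d f) := by rw [hd]
    rw [h1, h2, hbil, hbil]
    simp only [star_add, star_smul, star_star, smul_add, smul_smul, star_trivial, hε, one_smul]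
    rw [add_comm]
  let k : Dual Λ X.K →ₗ[Λ] X.K := -((ε : ℤ) • (d ∘ₗ adj ψ ∘ₗ d))
  have hk : ∀ f f' : Dual Λ X.K, f (k f') = -ψ (d f) (d f') := by
    intro f f'
    have : k f' = -((ε : ℤ) • d (adj ψ (d f'))) := rfl
    rw [this, map_neg, map_zsmul, hsw, smul_smul, hε, one_smul, adj_apply, star_star]
  let c : X.K × Dual Λ X.K →ₗ[Λ] X.K := LinearMap.fst _ _ _ + k ∘ₗ LinearMap.snd _ _ _
  let s : X.K × Dual Λ X.K →ₗ[Λ] X.K := d ∘ₗ LinearMap.snd _ _ _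
  let e : (X.K × Dual Λ X.K) ≃ₗ[Λ] X.K × X.K :=
    LinearEquiv.ofBijective ((c + s).prod c) (by
      constructor
      · rw [injective_iff_map_eq_zero]
        rintro ⟨x, f⟩ h
        have h1 : x + k f + d f = 0 := congrArg Prod.fst h
        have h2 : x + k f = 0 := congrArg Prod.snd h
        have h3 : d f = 0 := by rwa [h2, zero_add] at h1
        have hf : f = 0 := by rw [← hd f, h3, map_zero]
        subst hf
        have hx : x = 0 := by simpa using h2
        rw [hx]
        rfl
      · rintro ⟨a, b⟩
        refine ⟨(b - k (lam (a - b)), lam (a - b)), ?_⟩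
        have h3 : d (lam (a - b)) = a - b := lam.symm_apply_apply _
        refine Prod.ext ?_ ?_
        · change b - k (lam (a - b)) + k (lam (a - b)) + d (lam (a - b)) = a
          rw [h3]
          abel
        · change b - k (lam (a - b)) + k (lam (a - b)) = b
          abel)
  refine ⟨e, (pull_qSum _ _ _).trans ?_⟩
  change pull (c + s) X.form + pull c (-X.form) = Q.mk ε _
  let B : X.K × Dual Λ X.K →ₗ[Λ] Dual Λ (X.K × Dual Λ X.K) := dualMap s ∘ₗ ψ ∘ₗ c
  rw [map_neg, ← hψ, pull_mk, pull_mk]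
  rw [← sub_eq_zero, ← Q.mk_sub_T ε B]
  refine congrArg (Q.mk ε (M := X.K × Dual Λ X.K))
    (a₁ := pullHom (c + s) ψ + -pullHom c ψ -
      (dualMap (LinearMap.fst Λ X.K (Dual Λ X.K)) ∘ₗ LinearMap.snd Λ X.K (Dual Λ X.K))) ?_
  refine LinearMap.ext fun u => Dual.ext fun v => ?_
  have hB : ∀ u v, T ε B u v = (ε : ℤ) • star (ψ (c v) (s u)) := by
    intro u v
    rcases Int.units_eq_one_or ε with h | h <;> simp [T, h, B]
  have h1 : u.2 v.1 = ψ (s u) (c v) + (ε : ℤ) • star (ψ (c v) (s u)) + ψ (s u) (s v) := by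
    have h2 : u.2 (c v) = u.2 v.1 - ψ (s u) (s v) := by
      change u.2 (v.1 + k v.2) = _
      rw [map_add, hk, sub_eq_add_neg]
      rfl
    rw [← hbil, show X.bilin (s u) = u.2 from hd u.2, h2]
    abel
  simp only [LinearMap.sub_apply, LinearMap.add_apply, LinearMap.neg_apply, Dual.sub_apply,
    Dual.add_apply, Dual.neg_apply, pullHom_apply, hB, map_add]
  change _ - u.2 v.1 = ψ (c u) (s v) - _
  rw [h1]
  abel

variable (Λ ε) in
/-- The commutative monoid of isometry classes of `ε`-quadratic forms under direct sum. -/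
def Classes : Type (u + 1) := Quotient (setoid Λ ε)

/-- The isometry class of a form. -/
def cls (X : QForm Λ ε) : Classes Λ ε := Quotient.mk _ X

instance : Add (Classes Λ ε) := ⟨Quotient.map₂ sum fun _ _ h _ _ h' => sum_congr h h'⟩

instance : Zero (Classes Λ ε) := ⟨cls (trivial Λ ε)⟩

instance : AddCommMonoid (Classes Λ ε) where
  add_assoc := by
    rintro ⟨X⟩ ⟨Y⟩ ⟨Z⟩
    exact Quotient.sound (sum_assoc X Y Z)
  zero_add := by
    rintro ⟨X⟩
    exact Quotient.sound (trivial_sum X)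
  add_zero := by
    rintro ⟨X⟩
    exact Quotient.sound ((sum_comm X _).trans (trivial_sum X))
  add_comm := by
    rintro ⟨X⟩ ⟨Y⟩
    exact Quotient.sound (sum_comm X Y)
  nsmul := nsmulRec

theorem cls_sum (X Y : QForm Λ ε) : cls (X.sum Y) = cls X + cls Y := rfl

variable (Λ ε) in
/-- The classes of non-singular forms. -/
def nonsingularClasses : AddSubmonoid (Classes Λ ε) where
  carrier := {c | ∃ X : QForm Λ ε, X.Nonsingular ∧ cls X = c}
  zero_mem' := ⟨_, trivial_nonsingular, rfl⟩
  add_mem' := by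
    rintro _ _ ⟨X, hX, rfl⟩ ⟨Y, hY, rfl⟩
    exact ⟨X.sum Y, hX.sum hY, rfl⟩

variable (Λ ε) in
/-- The classes of hyperbolic forms `H_ε(P)`, `P` finitely generated free. -/
def hyperbolicClasses : AddSubmonoid (Classes Λ ε) where
  carrier := {c | ∃ (P : Type u) (_ : AddCommGroup P) (_ : Module Λ P) (_ : Module.Free Λ P)
    (_ : Module.Finite Λ P), cls (hyperbolic Λ ε P) = c}
  zero_mem' := ⟨PUnit, inferInstance, inferInstance, inferInstance, inferInstance,
    (Quotient.sound trivial_isometric_hyperbolic).symm⟩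
  add_mem' := by
    rintro _ _ ⟨P, _, _, _, _, rfl⟩ ⟨P', _, _, _, _, rfl⟩
    exact ⟨P × P', inferInstance, inferInstance, inferInstance, inferInstance,
      (Quotient.sound (hyperbolic_sum P P')).symm⟩

end QForm

variable (Λ) in
/-- The Witt group of non-singular `ε`-quadratic forms on finitely generated free modules, modulo
hyperbolic forms. The group `L_{2k}(Λ)` is `LGroup Λ ((-1)^k)`. -/
def LGroup (ε : ℤˣ) : Type (u + 1) :=
  (stableCon ((QForm.hyperbolicClasses Λ ε).comap
    (QForm.nonsingularClasses Λ ε).subtype)).Quotient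

instance : AddCommMonoid (LGroup Λ ε) := inferInstanceAs (AddCommMonoid (AddCon.Quotient _))

/-- The class `[(K, θ)]` of a non-singular form. -/
def LGroup.mk (X : QForm Λ ε) (hX : X.Nonsingular) : LGroup Λ ε :=
  AddCon.toQuotient (c := stableCon _) ⟨QForm.cls X, X, hX, rfl⟩

theorem LGroup.exists_neg (x : LGroup Λ ε) : ∃ y, y + x = 0 := by
  obtain ⟨⟨_, X, hX, rfl⟩, rfl⟩ := Quotient.exists_rep x
  refine ⟨LGroup.mk X.neg hX.neg, ?_⟩
  refine (AddCon.eq _).2 ⟨0, AddSubmonoid.zero_mem _, ⟨QForm.cls (X.sum X.neg), _,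
    hX.sum hX.neg, rfl⟩, ?_, ?_⟩
  · exact ⟨X.K, inferInstance, inferInstance, inferInstance, inferInstance,
      Quotient.sound (QForm.hyperbolic_isometric_sum_neg X hX)⟩
  · rw [add_zero, zero_add]
    exact Subtype.ext (add_comm (QForm.cls X.neg) (QForm.cls X))

instance : AddCommGroup (LGroup Λ ε) := groupOfExistsNeg LGroup.exists_neg

end Forms

/-! ## Preformations -/

section Preformations

variable (Λ : Type u) [Ring Λ] [StarRing Λ]

/-- A regular `ε`-quadratic split preformation `(F ←γ- G -μ→ F*, θ)`: `F` and `G` are finitely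
generated free, `θ ∈ Q_{-ε}(G)`, and `(G, γ*μ, θ)` is a `(-ε)`-quadratic form. -/
structure Preformation (ε : ℤˣ) where
  F : Type u
  G : Type u
  [addCommGroupF : AddCommGroup F]
  [moduleF : Module Λ F]
  [freeF : Module.Free Λ F]
  [finiteF : Module.Finite Λ F]
  [addCommGroupG : AddCommGroup G]
  [moduleG : Module Λ G]
  [freeG : Module.Free Λ G]
  [finiteG : Module.Finite Λ G]
  γ : G →ₗ[Λ] F
  μ : G →ₗ[Λ] Dual Λ F
  θ : Q Λ (-ε) G
  symmetrize_eq : symmetrize (-ε) θ = dualMap γ ∘ₗ μ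

attribute [instance] Preformation.addCommGroupF Preformation.moduleF Preformation.freeF
  Preformation.finiteF Preformation.addCommGroupG Preformation.moduleG Preformation.freeG
  Preformation.finiteG

variable {Λ} {ε : ℤˣ}

/-- The boundary `∂(K, θ) = (K ←1- K -(θ - ε θ*)→ K*, θ)` of a `(-ε)`-quadratic form. -/
def QForm.boundary (X : QForm Λ (-ε)) : Preformation Λ ε where
  F := X.K
  G := X.K
  γ := LinearMap.id
  μ := X.bilin
  θ := X.form
  symmetrize_eq := rfl

namespace Preformation

/-- The sum of two preformations. -/
def sum (z z' : Preformation Λ ε) : Preformation Λ ε where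
  F := z.F × z'.F
  G := z.G × z'.G
  γ := z.γ.prodMap z'.γ
  μ := dualSum z.μ z'.μ
  θ := qSum z.θ z'.θ
  symmetrize_eq := by
    rw [symmetrize_qSum, z.symmetrize_eq, z'.symmetrize_eq]
    rfl

variable (Λ ε) in
/-- The preformation on zero modules. -/
def trivial : Preformation Λ ε := (QForm.trivial Λ (-ε)).boundary

/-- The flip `(F* ←εμ- G -γ→ F, -θ)`, where `F` is identified with `F**`. -/
def flip (z : Preformation Λ ε) : Preformation Λ ε where
  F := Dual Λ z.F
  G := z.G
  γ := (ε : ℤ) • z.μ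
  μ := ev ∘ₗ z.γ
  θ := -z.θ
  symmetrize_eq := by
    have h : T (-ε) (symmetrize (-ε) z.θ) = symmetrize (-ε) z.θ := by
      obtain ⟨ψ, hψ⟩ := Q.exists_mk z.θ
      rw [← hψ, symmetrize_mk, map_add, T_T, add_comm]
    rw [map_neg, ← h, z.symmetrize_eq]
    ext x y
    rcases Int.units_eq_one_or ε with h | h <;> simp [T, h]

/-- A strong isomorphism: isomorphisms `α : F → F'`, `β : G → G'` with `α γ = γ' β`,
`α^{-*} μ = μ' β` and `θ = β* θ' β`. -/
def StrongIso (z z' : Preformation Λ ε) : Prop :=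
  ∃ (α : z.F ≃ₗ[Λ] z'.F) (β : z.G ≃ₗ[Λ] z'.G),
    α.toLinearMap ∘ₗ z.γ = z'.γ ∘ₗ β.toLinearMap ∧
    (invDual α).toLinearMap ∘ₗ z.μ = z'.μ ∘ₗ β.toLinearMap ∧
    z.θ = pull β.toLinearMap z'.θ

/-- For `ν ∈ Q_{-ε}(F*)`, the map `(ν - ε ν*)* = ν* - ε ν : F* → F** = F`. -/
def sigma {F : Type u} [AddCommGroup F] [Module Λ F] [Module.Free Λ F] [Module.Finite Λ F]
    (ν : Q Λ (-ε) (Dual Λ F)) : Dual Λ F →ₗ[Λ] F :=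
  evEquiv.symm.toLinearMap ∘ₗ adj (symmetrize (-ε) ν)

/-- A weak isomorphism `(α, β, ν)` of regular split preformations. -/
structure WeakIso (z z' : Preformation Λ ε) where
  α : z.F ≃ₗ[Λ] z'.F
  β : z.G ≃ₗ[Λ] z'.G
  ν : Q Λ (-ε) (Dual Λ z.F)
  comm_γ : α.toLinearMap ∘ₗ z.γ + α.toLinearMap ∘ₗ sigma ν ∘ₗ z.μ = z'.γ ∘ₗ β.toLinearMap
  comm_μ : (invDual α).toLinearMap ∘ₗ z.μ = z'.μ ∘ₗ β.toLinearMap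
  comm_θ : z.θ + pull z.μ ν = pull β.toLinearMap z'.θ

/-- A flip-isomorphism of `z` is a weak isomorphism of `z` with its flip. -/
abbrev FlipIso (z : Preformation Λ ε) := WeakIso z z.flip

/-- A flip-isomorphism `(α, β, ν)` is strong if `ν = 0 ∈ Q_{-ε}(F*)`. -/
def FlipIso.IsStrong {z : Preformation Λ ε} (t : FlipIso z) : Prop := WeakIso.ν t = 0

/-- A stable flip-isomorphism of `z` is a flip-isomorphism of `z + ∂H_{-ε}(P)`, for some finitely
generated free module `P`. -/
structure StableFlipIso (z : Preformation Λ ε) where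
  P : Type u
  [addCommGroup : AddCommGroup P]
  [module : Module Λ P]
  [free : Module.Free Λ P]
  [finite : Module.Finite Λ P]
  flipIso : FlipIso (z.sum (QForm.hyperbolic Λ (-ε) P).boundary)

attribute [instance] StableFlipIso.addCommGroup StableFlipIso.module StableFlipIso.free
  StableFlipIso.finite

/-- `U` is an `h`-lagrangian of the preformation: it is finitely generated free, `γ*μ` and `θ`
vanish on `U`, the maps `γ|U` and `μ|U` are injective with images `U₀ ⊆ F` and `U₁ ⊆ F*` direct
summands, and restriction of functionals induces an isomorphism `F*/U₁ → U₀*`. -/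
structure IsHLagrangian (z : Preformation Λ ε) (U : Submodule Λ z.G) : Prop where
  free : Module.Free Λ U
  finite : Module.Finite Λ U
  bilin_eq_zero : ∀ x ∈ U, ∀ y ∈ U, z.μ x (z.γ y) = 0
  form_eq_zero : pull U.subtype z.θ = 0
  injective_γ : Function.Injective (z.γ ∘ₗ U.subtype)
  injective_μ : Function.Injective (z.μ ∘ₗ U.subtype)
  summand_γ : ∃ C : Submodule Λ z.F, IsCompl (U.map z.γ) C
  summand_μ : ∃ C : Submodule Λ (Dual Λ z.F), IsCompl (U.map z.μ) C
  restrict_ker : LinearMap.ker (dualMap (U.map z.γ).subtype) = U.map z.μ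
  restrict_surjective : Function.Surjective (dualMap (U.map z.γ).subtype)

/-- A preformation is elementary if it has an `h`-lagrangian. -/
def IsElementary (z : Preformation Λ ε) : Prop := ∃ U, z.IsHLagrangian U

/-- A non-singular split formation: `(γ, μ) : G → F ⊕ F*` is the inclusion of a lagrangian of the
hyperbolic form `H_ε(F)`. -/
def IsNonsingularFormation (z : Preformation Λ ε) : Prop :=
  Function.Injective (z.γ.prod z.μ) ∧
    (QForm.hyperbolic Λ ε z.F).IsLagrangian (LinearMap.range (z.γ.prod z.μ))

/-! ### The `l`-monoid -/

theorem StrongIso.refl (z : Preformation Λ ε) : StrongIso z z :=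
  ⟨LinearEquiv.refl Λ _, LinearEquiv.refl Λ _, rfl, rfl, (pull_id _).symm⟩

theorem StrongIso.symm {z z' : Preformation Λ ε} : StrongIso z z' → StrongIso z' z := by
  rintro ⟨α, β, h1, h2, h3⟩
  refine ⟨α.symm, β.symm, ?_, ?_, ?_⟩
  · ext y
    obtain ⟨x, rfl⟩ := β.surjective y
    have := LinearMap.congr_fun h1 x
    simp only [LinearMap.comp_apply, LinearEquiv.coe_coe] at this
    simp [← this]
  · ext y v
    obtain ⟨x, rfl⟩ := β.surjective y
    have := congrArg (fun f : Dual Λ z'.F => f (α v)) (LinearMap.congr_fun h2 x)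
    simp only [LinearMap.comp_apply, LinearEquiv.coe_coe, invDual_apply,
      LinearEquiv.symm_apply_apply] at this
    simp [this]
  · rw [h3, pull_pull]
    convert (pull_id z'.θ).symm using 2
    ext x
    simp

theorem StrongIso.trans {z z' z'' : Preformation Λ ε} :
    StrongIso z z' → StrongIso z' z'' → StrongIso z z'' := by
  rintro ⟨α, β, h1, h2, h3⟩ ⟨α', β', h1', h2', h3'⟩
  refine ⟨α.trans α', β.trans β', ?_, ?_, ?_⟩
  · ext x
    have e1 := LinearMap.congr_fun h1 x
    have e2 := LinearMap.congr_fun h1' (β x)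
    simp only [LinearMap.comp_apply, LinearEquiv.coe_coe] at e1 e2
    simp [e1, e2]
  · ext x v
    have e1 := congrArg (fun f : Dual Λ z'.F => f (α'.symm v)) (LinearMap.congr_fun h2 x)
    have e2 := congrArg (fun f : Dual Λ z''.F => f v) (LinearMap.congr_fun h2' (β x))
    simp only [LinearMap.comp_apply, LinearEquiv.coe_coe, invDual_apply] at e1 e2
    simp [e1, e2]
  · rw [h3, h3', pull_pull]
    rfl

variable (Λ ε) in
/-- Strong isomorphism of preformations, as an equivalence relation. -/
def setoid : Setoid (Preformation Λ ε) :=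
  ⟨StrongIso, StrongIso.refl, StrongIso.symm, StrongIso.trans⟩

theorem sum_congr {x x' y y' : Preformation Λ ε} :
    StrongIso x x' → StrongIso y y' → StrongIso (x.sum y) (x'.sum y') := by
  rintro ⟨α, β, h1, h2, h3⟩ ⟨α', β', h1', h2', h3'⟩
  refine ⟨α.prodCongr α', β.prodCongr β', ?_, ?_, ?_⟩
  · refine LinearMap.ext fun v => Prod.ext ?_ ?_
    · exact LinearMap.congr_fun h1 v.1
    · exact LinearMap.congr_fun h1' v.2
  · refine LinearMap.ext fun v => Dual.ext fun w => ?_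
    have e1 := congrArg (fun f : Dual Λ x'.F => f w.1) (LinearMap.congr_fun h2 v.1)
    have e2 := congrArg (fun f : Dual Λ y'.F => f w.2) (LinearMap.congr_fun h2' v.2)
    exact congrArg₂ (· + ·) e1 e2
  · refine Eq.trans ?_ (pull_qSum _ _ _).symm
    change qSum x.θ y.θ = _
    rw [h3, h3', qSum, pull_pull, pull_pull]
    rfl

theorem sum_comm (x y : Preformation Λ ε) : StrongIso (x.sum y) (y.sum x) := by
  refine ⟨LinearEquiv.prodComm Λ _ _, LinearEquiv.prodComm Λ _ _, rfl, ?_, ?_⟩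
  · refine LinearMap.ext fun v => Dual.ext fun w => ?_
    exact add_comm (x.μ v.1 w.2) (y.μ v.2 w.1)
  · refine Eq.trans ?_ (pull_qSum _ _ _).symm
    rw [add_comm]
    rfl

theorem sum_assoc (x y z : Preformation Λ ε) :
    StrongIso ((x.sum y).sum z) (x.sum (y.sum z)) := by
  refine ⟨LinearEquiv.prodAssoc Λ _ _ _, LinearEquiv.prodAssoc Λ _ _ _, rfl, ?_, ?_⟩
  · refine LinearMap.ext fun v => Dual.ext fun w => ?_
    exact add_assoc (x.μ v.1.1 w.1) (y.μ v.1.2 w.2.1) (z.μ v.2 w.2.2)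
  · refine Eq.trans ?_ ((congrArg _ (pull_qSum _ _ _)).symm.trans (pull_qSum _ _ _).symm)
    change qSum (qSum x.θ y.θ) z.θ = _
    rw [qSum, qSum, map_add, pull_pull, pull_pull, add_assoc]
    rfl

theorem trivial_sum (x : Preformation Λ ε) : StrongIso ((trivial Λ ε).sum x) x := by
  refine ⟨LinearEquiv.uniqueProd (M₂ := PUnit.{u + 1}),
    LinearEquiv.uniqueProd (M₂ := PUnit.{u + 1}), rfl, ?_, ?_⟩
  · refine LinearMap.ext fun v => Dual.ext fun w => ?_
    have h : (QForm.trivial Λ (-ε)).bilin v.1 PUnit.unit = 0 :=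
      map_zero ((QForm.trivial Λ (-ε)).bilin v.1)
    change (QForm.trivial Λ (-ε)).bilin v.1 PUnit.unit + x.μ v.2 w = x.μ v.2 w
    rw [h, zero_add]
  · change qSum (0 : Q Λ (-ε) PUnit) x.θ = _
    rw [qSum, map_zero, zero_add]
    rfl

theorem boundary_congr {X Y : QForm Λ (-ε)} :
    X.Isometric Y → StrongIso X.boundary Y.boundary := by
  rintro ⟨f, hf⟩
  refine ⟨f, f, rfl, ?_, hf.symm⟩
  refine LinearMap.ext fun v => Dual.ext fun w => ?_
  change X.bilin v (f.symm w) = Y.bilin (f v) w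
  have : X.bilin = pullHom f.toLinearMap Y.bilin := by
    rw [QForm.bilin, ← hf]
    exact symmetrize_pull _ _
  rw [this]
  change Y.bilin (f v) (f (f.symm w)) = Y.bilin (f v) w
  exact congrArg (Y.bilin (f v)) (f.apply_symm_apply w)

theorem boundary_sum (X Y : QForm Λ (-ε)) :
    StrongIso (X.sum Y).boundary (X.boundary.sum Y.boundary) :=
  ⟨LinearEquiv.refl Λ _, LinearEquiv.refl Λ _, rfl,
    congrArg (fun φ : X.K × Y.K →ₗ[Λ] Dual Λ (X.K × Y.K) => φ) (symmetrize_qSum X.form Y.form),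
    (pull_id _).symm⟩

variable (Λ ε) in
/-- The commutative monoid of strong isomorphism classes of regular preformations. -/
def Classes : Type (u + 1) := Quotient (setoid Λ ε)

/-- The strong isomorphism class of a preformation. -/
def cls (z : Preformation Λ ε) : Classes Λ ε := Quotient.mk _ z

instance : Add (Classes Λ ε) := ⟨Quotient.map₂ sum fun _ _ h _ _ h' => sum_congr h h'⟩

instance : Zero (Classes Λ ε) := ⟨cls (trivial Λ ε)⟩

instance : AddCommMonoid (Classes Λ ε) where
  add_assoc := by
    rintro ⟨x⟩ ⟨y⟩ ⟨z⟩
    exact Quotient.sound (sum_assoc x y z)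
  zero_add := by
    rintro ⟨x⟩
    exact Quotient.sound (trivial_sum x)
  add_zero := by
    rintro ⟨x⟩
    exact Quotient.sound ((sum_comm x _).trans (trivial_sum x))
  add_comm := by
    rintro ⟨x⟩ ⟨y⟩
    exact Quotient.sound (sum_comm x y)
  nsmul := nsmulRec

variable (Λ ε) in
/-- The classes of the boundaries `∂H_{-ε}(P)`, `P` finitely generated free. -/
def hyperbolicClasses : AddSubmonoid (Classes Λ ε) where
  carrier := {c | ∃ (P : Type u) (_ : AddCommGroup P) (_ : Module Λ P) (_ : Module.Free Λ P)
    (_ : Module.Finite Λ P), cls (QForm.hyperbolic Λ (-ε) P).boundary = c}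
  zero_mem' := ⟨PUnit, inferInstance, inferInstance, inferInstance, inferInstance,
    (Quotient.sound (boundary_congr QForm.trivial_isometric_hyperbolic)).symm⟩
  add_mem' := by
    rintro _ _ ⟨P, _, _, _, _, rfl⟩ ⟨P', _, _, _, _, rfl⟩
    exact ⟨P × P', inferInstance, inferInstance, inferInstance, inferInstance,
      Quotient.sound ((boundary_congr (QForm.hyperbolic_sum P P')).symm.trans
        (boundary_sum _ _))⟩

end Preformation

variable (Λ) in
/-- The `l`-monoid of regular `ε`-quadratic split preformations up to stable strong isomorphism,
i.e. strong isomorphism after adding boundaries of hyperbolic forms. The monoid `l_{2q+2}(Λ)` is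
`LMonoid Λ ((-1)^q)`. -/
def LMonoid (ε : ℤˣ) : Type (u + 1) := (stableCon (Preformation.hyperbolicClasses Λ ε)).Quotient

instance : AddCommMonoid (LMonoid Λ ε) := inferInstanceAs (AddCommMonoid (AddCon.Quotient _))

/-- The class `[z]` of a preformation in the `l`-monoid. -/
def LMonoid.mk (z : Preformation Λ ε) : LMonoid Λ ε :=
  AddCon.toQuotient (c := stableCon _) z.cls

/-- An element of the `l`-monoid is elementary if it has an elementary representative. -/
def LMonoid.IsElementary (c : LMonoid Λ ε) : Prop :=
  ∃ z : Preformation Λ ε, z.IsElementary ∧ LMonoid.mk z = c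

end Preformations

/-! ## Asymmetric forms and asymmetric signatures -/

section Asymmetric

variable (Λ : Type u) [Ring Λ] [StarRing Λ]

/-- A non-singular asymmetric form: a finitely generated free module `M` together with an
isomorphism `lam : M → M*`. -/
structure AsymForm where
  M : Type u
  [addCommGroup : AddCommGroup M]
  [module : Module Λ M]
  [free : Module.Free Λ M]
  [finite : Module.Finite Λ M]
  lam : M →ₗ[Λ] Dual Λ M
  nonsingular : Function.Bijective lam

attribute [instance] AsymForm.addCommGroup AsymForm.module AsymForm.free AsymForm.finite

variable {Λ} {ε : ℤˣ}

namespace AsymForm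

/-- A lagrangian: a direct summand `L` with `L = L^⊥`, `L^⊥ = {x ∈ M | lam x vanishes on L}`. -/
def IsLagrangian (A : AsymForm Λ) (L : Submodule Λ A.M) : Prop :=
  (∃ C : Submodule Λ A.M, IsCompl L C) ∧ ∀ x, x ∈ L ↔ ∀ y ∈ L, A.lam x y = 0

/-- A form is metabolic if it has a lagrangian. -/
def IsMetabolic (A : AsymForm Λ) : Prop := ∃ L, A.IsLagrangian L

/-- Isometry of asymmetric forms. -/
def Isometric (A B : AsymForm Λ) : Prop :=
  ∃ f : A.M ≃ₗ[Λ] B.M, ∀ x y, B.lam (f x) (f y) = A.lam x y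

/-- The direct sum of two forms. -/
def sum (A B : AsymForm Λ) : AsymForm Λ :=
  ⟨A.M × B.M, dualSum A.lam B.lam, dualSum_bijective A.nonsingular B.nonsingular⟩

variable (Λ) in
/-- The form on the zero module. -/
def trivial : AsymForm Λ := 
  ⟨PUnit, 0, fun _ _ _ => rfl, fun f => ⟨0, Dual.ext fun x => by
    rw [Subsingleton.elim x 0, map_zero, map_zero]⟩⟩

/-- The form `(M, -lam)`. -/
def neg (A : AsymForm Λ) : AsymForm Λ :=
  ⟨A.M, -A.lam, neg_involutive.bijective.comp A.nonsingular⟩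

theorem Isometric.refl (A : AsymForm Λ) : Isometric A A := ⟨LinearEquiv.refl Λ _, fun _ _ => rfl⟩

theorem Isometric.symm {A B : AsymForm Λ} : Isometric A B → Isometric B A := by
  rintro ⟨f, hf⟩
  exact ⟨f.symm, fun x y => by rw [← hf]; simp⟩

theorem Isometric.trans {A B C : AsymForm Λ} :
    Isometric A B → Isometric B C → Isometric A C := by
  rintro ⟨f, hf⟩ ⟨g, hg⟩
  exact ⟨f.trans g, fun x y => by rw [← hf, ← hg]; rfl⟩

variable (Λ) in
/-- Isometry of asymmetric forms, as an equivalence relation. -/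
def setoid : Setoid (AsymForm Λ) := ⟨Isometric, Isometric.refl, Isometric.symm, Isometric.trans⟩

theorem sum_congr {A A' B B' : AsymForm Λ} :
    Isometric A A' → Isometric B B' → Isometric (A.sum B) (A'.sum B') := by
  rintro ⟨f, hf⟩ ⟨g, hg⟩
  exact ⟨f.prodCongr g, fun x y => congrArg₂ (· + ·) (hf x.1 y.1) (hg x.2 y.2)⟩

theorem sum_comm (A B : AsymForm Λ) : Isometric (A.sum B) (B.sum A) :=
  ⟨LinearEquiv.prodComm Λ _ _, fun x y => add_comm (B.lam x.2 y.2) (A.lam x.1 y.1)⟩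

theorem sum_assoc (A B C : AsymForm Λ) :
    Isometric ((A.sum B).sum C) (A.sum (B.sum C)) :=
  ⟨LinearEquiv.prodAssoc Λ _ _ _, fun x y =>
    (add_assoc (A.lam x.1.1 y.1.1) (B.lam x.1.2 y.1.2) (C.lam x.2 y.2)).symm⟩

theorem trivial_sum (A : AsymForm Λ) : Isometric ((trivial Λ).sum A) A :=
  ⟨LinearEquiv.uniqueProd (M₂ := PUnit.{u + 1}), fun x y => (zero_add (A.lam x.2 y.2)).symm⟩

theorem trivial_isMetabolic : (trivial Λ).IsMetabolic :=
  ⟨⊥, ⟨⊤, isCompl_bot_top⟩, fun x =>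
    ⟨fun _ _ _ => rfl, fun _ => (Submodule.mem_bot Λ).2 (Subsingleton.elim (α := PUnit) x 0)⟩⟩

theorem IsMetabolic.sum {A B : AsymForm Λ} :
    A.IsMetabolic → B.IsMetabolic → (A.sum B).IsMetabolic := by
  rintro ⟨L, ⟨C, hC⟩, hL⟩ ⟨L', ⟨C', hC'⟩, hL'⟩
  refine ⟨L.prod L', ⟨C.prod C', ?_⟩, ?_⟩
  · refine IsCompl.of_eq ?_ ?_
    · refine (Submodule.prod_inf_prod _ _ _ _).trans ?_
      rw [hC.inf_eq_bot, hC'.inf_eq_bot]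
      exact Submodule.prod_bot
    · refine (Submodule.prod_sup_prod _ _ _ _).trans ?_
      rw [hC.sup_eq_top, hC'.sup_eq_top]
      exact Submodule.prod_top
  · rintro ⟨x, x'⟩
    have e : ∀ y y', (A.sum B).lam (x, x') (y, y') = A.lam x y + B.lam x' y' := fun _ _ => rfl
    constructor
    · rintro ⟨hx, hx'⟩ ⟨y, y'⟩ ⟨hy, hy'⟩
      rw [e, (hL x).1 hx y hy, (hL' x').1 hx' y' hy', add_zero]
    · intro h
      refine ⟨(hL x).2 fun y hy => ?_, (hL' x').2 fun y' hy' => ?_⟩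
      · have := h (y, 0) ⟨hy, L'.zero_mem⟩
        rwa [e, map_zero, add_zero] at this
      · have := h (0, y') ⟨L.zero_mem, hy'⟩
        rwa [e, map_zero, zero_add] at this

theorem sum_neg_isMetabolic (A : AsymForm Λ) : (A.sum A.neg).IsMetabolic := by
  refine ⟨LinearMap.range ((LinearMap.id (R := Λ) (M := A.M)).prod LinearMap.id),
    ⟨LinearMap.range (LinearMap.inl Λ A.M A.M), ?_⟩, ?_⟩
  · refine IsCompl.of_eq ?_ ?_
    · refine (Submodule.eq_bot_iff _).2 ?_
      rintro _ ⟨⟨x, rfl⟩, ⟨y, hy⟩⟩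
      have h : (0 : A.M) = x := congrArg Prod.snd hy
      rw [← h]
      rfl
    · refine Submodule.eq_top_iff'.2 ?_
      rintro ⟨(x : A.M), (y : A.M)⟩
      refine Submodule.mem_sup.2 ⟨(y, y), ⟨y, rfl⟩, (x - y, 0), ⟨x - y, rfl⟩, ?_⟩
      refine Prod.ext ?_ ?_
      · exact add_sub_cancel y x
      · exact add_zero y
  · rintro ⟨x, x'⟩
    have e : ∀ y, (A.sum A.neg).lam (x, x') (y, y) = A.lam x y + -A.lam x' y := fun _ => rfl
    constructor
    · rintro ⟨w, hw⟩ _ ⟨y, rfl⟩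
      have h1 : w = x := congrArg Prod.fst hw
      have h2 : w = x' := congrArg Prod.snd hw
      refine (e y).trans ?_
      rw [← h1, ← h2, add_neg_cancel]
    · intro h
      have : x = x' := by
        apply A.nonsingular.1
        refine Dual.ext fun y => ?_
        have := h (y, y) ⟨y, rfl⟩
        rw [e] at this
        exact add_neg_eq_zero.1 this
      exact ⟨x, Prod.ext rfl this⟩

variable (Λ) in
/-- The commutative monoid of isometry classes of non-singular asymmetric forms. -/
def Classes : Type (u + 1) := Quotient (setoid Λ)

/-- The isometry class of a form. -/
def cls (A : AsymForm Λ) : Classes Λ := Quotient.mk _ A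

instance : Add (Classes Λ) := ⟨Quotient.map₂ sum fun _ _ h _ _ h' => sum_congr h h'⟩

instance : Zero (Classes Λ) := ⟨cls (trivial Λ)⟩

instance : AddCommMonoid (Classes Λ) where
  add_assoc := by
    rintro ⟨A⟩ ⟨B⟩ ⟨C⟩
    exact Quotient.sound (sum_assoc A B C)
  zero_add := by
    rintro ⟨A⟩
    exact Quotient.sound (trivial_sum A)
  add_zero := by
    rintro ⟨A⟩
    exact Quotient.sound ((sum_comm A _).trans (trivial_sum A))
  add_comm := by
    rintro ⟨A⟩ ⟨B⟩
    exact Quotient.sound (sum_comm A B)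
  nsmul := nsmulRec

variable (Λ) in
/-- The classes of metabolic forms. -/
def metabolicClasses : AddSubmonoid (Classes Λ) where
  carrier := {c | ∃ A : AsymForm Λ, A.IsMetabolic ∧ cls A = c}
  zero_mem' := ⟨_, trivial_isMetabolic, rfl⟩
  add_mem' := by
    rintro _ _ ⟨A, hA, rfl⟩ ⟨B, hB, rfl⟩
    exact ⟨A.sum B, hA.sum hB, rfl⟩

end AsymForm

variable (Λ) in
/-- The asymmetric Witt group `LAsy⁰(Λ)` of non-singular asymmetric forms modulo metabolic
forms. -/
def LAsy : Type (u + 1) := (stableCon (AsymForm.metabolicClasses Λ)).Quotient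

instance : AddCommMonoid (LAsy Λ) := inferInstanceAs (AddCommMonoid (AddCon.Quotient _))

/-- The class of a form in `LAsy⁰(Λ)`. -/
def LAsy.mk (A : AsymForm Λ) : LAsy Λ := AddCon.toQuotient (c := stableCon _) A.cls

theorem LAsy.exists_neg (x : LAsy Λ) : ∃ y, y + x = 0 := by
  obtain ⟨⟨A⟩, rfl⟩ := Quotient.exists_rep x
  refine ⟨LAsy.mk A.neg, ?_⟩
  refine (AddCon.eq _).2 ⟨0, AddSubmonoid.zero_mem _, AsymForm.cls (A.sum A.neg),
    ⟨_, A.sum_neg_isMetabolic, rfl⟩, ?_⟩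
  rw [add_zero, zero_add]
  exact add_comm (AsymForm.cls A.neg) (AsymForm.cls A)

instance : AddCommGroup (LAsy Λ) := groupOfExistsNeg LAsy.exists_neg

/-- A non-singular quadratic form `(K, θ)` gives the asymmetric form `(K, θ + ε θ*)`. -/
def QForm.asymForm (X : QForm Λ ε) (hX : X.Nonsingular) : AsymForm Λ := ⟨X.K, X.bilin, hX⟩

namespace Preformation

variable {z : Preformation Λ ε}

/-- For a flip-isomorphism `(α, β, ν)` of `z`, the asymmetric form
`(0 0 α; 1 0 -ε; 0 1 ε α (ν* - ε ν) α*)` on `F ⊕ F* ⊕ F`. -/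
def FlipIso.rho (t : FlipIso z) :
    (z.F × Dual Λ z.F × z.F) →ₗ[Λ] Dual Λ (z.F × Dual Λ z.F × z.F) :=
  let α : z.F →ₗ[Λ] Dual Λ z.F := (WeakIso.α t).toLinearMap
  let σ : Dual Λ z.F →ₗ[Λ] z.F := sigma (WeakIso.ν t)
  let p₁ : (z.F × Dual Λ z.F × z.F) →ₗ[Λ] z.F := LinearMap.fst _ _ _
  let p₂ : (z.F × Dual Λ z.F × z.F) →ₗ[Λ] Dual Λ z.F := LinearMap.fst _ _ _ ∘ₗ LinearMap.snd _ _ _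
  let p₃ : (z.F × Dual Λ z.F × z.F) →ₗ[Λ] z.F := LinearMap.snd _ _ _ ∘ₗ LinearMap.snd _ _ _
  dualProd.toLinearMap ∘ₗ (α ∘ₗ p₃).prod
    (dualProd.toLinearMap ∘ₗ (ev ∘ₗ (p₁ - (ε : ℤ) • p₃)).prod
      (p₂ + (ε : ℤ) • (α ∘ₗ σ ∘ₗ adj α ∘ₗ p₃)))

theorem FlipIso.rho_bijective (t : FlipIso z) : Function.Bijective t.rho := by
  refine dualProd.bijective.comp ?_
  constructor
  · rw [injective_iff_map_eq_zero]
    rintro ⟨x, y, w⟩ h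
    have h1 : WeakIso.α t w = 0 := congrArg Prod.fst h
    have h2 := dualProd.injective ((congrArg Prod.snd h).trans (map_zero _).symm)
    have hw : w = 0 := by simpa using h1
    subst hw
    have h3 := ev_bijective.1 ((congrArg Prod.fst h2).trans (map_zero _).symm)
    have h4 := congrArg Prod.snd h2
    have h5 : x - (ε : ℤ) • (0 : z.F) = 0 := h3
    rw [smul_zero, sub_zero] at h5
    subst h5
    let α : z.F →ₗ[Λ] Dual Λ z.F := (WeakIso.α t).toLinearMap
    have h6 : y + (ε : ℤ) • α (sigma (WeakIso.ν t) (adj α 0)) = 0 := h4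
    rw [map_zero, map_zero, map_zero, smul_zero, add_zero] at h6
    rw [h6]
    rfl
  · rintro ⟨a, bc⟩
    obtain ⟨⟨b, c⟩, rfl⟩ := dualProd.surjective bc
    obtain ⟨w, rfl⟩ := (WeakIso.α t).surjective a
    obtain ⟨v, rfl⟩ := ev_bijective.2 b
    let α : z.F →ₗ[Λ] Dual Λ z.F := (WeakIso.α t).toLinearMap
    refine ⟨(v + (ε : ℤ) • w, c - (ε : ℤ) • (α (sigma (WeakIso.ν t) (adj α w))), w), ?_⟩
    refine Prod.ext rfl ?_
    refine congrArg dualProd (Prod.ext ?_ ?_)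
    · refine congrArg ev ?_
      exact add_sub_cancel_right v ((ε : ℤ) • w)
    · exact sub_add_cancel c _

/-- The asymmetric signature `σ*(z, t) ∈ LAsy⁰(Λ)` of a flip-isomorphism `t` of `z`. -/
def FlipIso.asymSignature (t : FlipIso z) : LAsy Λ :=
  LAsy.mk ⟨z.F × Dual Λ z.F × z.F, FlipIso.rho t, FlipIso.rho_bijective t⟩

/-- The asymmetric signature of a stable flip-isomorphism. -/
def StableFlipIso.asymSignature (s : StableFlipIso z) : LAsy Λ := FlipIso.asymSignature s.flipIso

end Preformation

end Asymmetric

end LTheory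

end

/-! Write `λ = θ - εθ*`. In `z = ∂(K,θ)` the map `γ` is the identity and `μ = λ`, so `z` is the
graph of `λ`, and each structure on `z` translates into one on `(K,θ)`.

Flip-isomorphisms. The equation for `μ` writes `λ` as a composite of isomorphisms, so `(K,θ)` is
non-singular. Conversely, if `λ` is invertible, that equation determines `α` from `β`, the equation
for `γ` follows by symmetrizing the one for `θ`, and only `θ + λ*νλ = -β*θβ` remains
(`exists_flipIso`). For `β = 1` it can be solved for `ν`; for `ν = 0` it says that `β` is an
isometry from `(K,θ)` to `(K,-θ)`. A stable strong flip-isomorphism is thus an isometry of some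
`(K,θ) ⊕ H(P)` with its negative, which forces `2[(K,θ)] = 0`. The converse is the only place where
stable finiteness enters: it makes ranks well defined, so that an isometry of `2(K,θ) ⊕ H(P)` with
`H(P')` yields `P' ≅ K ⊕ P`.

Elementariness. An h-lagrangian of a boundary splits off its dual, so the form is hyperbolic
(`exists_isometric_hyperbolic`); non-singularity is a consequence here. Sums with `∂H(P)` remain
elementary, which gives the statement about the `l`-monoid.

Asymmetric signature. For non-singular `(K,θ)`, the form `rho ⊕ -λ` on `K ⊕ K* ⊕ K ⊕ K` has an
explicit lagrangian parametrized by `K ⊕ K` (`asymSignature_eq`).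

Fields and the integers. Over a principal ideal domain, if `λ` vanishes in the asymmetric Witt group
then a rank count yields an isotropic submodule of at least half rank, whose orthogonal is a
lagrangian of `λ` (`exists_lagrangian`). Under the hypotheses of the last part `θ` vanishes wherever
`λ` does, so this lagrangian is an h-lagrangian of `z`. -/

noncomputable section

namespace LTheory

/-! ### Calculus in `Q_η(M)` -/

section QLemmas

variable {Λ : Type u} [Ring Λ] [StarRing Λ] {η : ℤˣ}
variable {M N : Type u} [AddCommGroup M] [Module Λ M] [AddCommGroup N] [Module Λ N]

theorem coe_unit_mul_self (η : ℤˣ) : (η : ℤ) * η = 1 := by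
  rw [← Units.val_mul, Int.units_mul_self, Units.val_one]

theorem T_apply (φ : M →ₗ[Λ] Dual Λ M) (x y : M) :
    T η φ x y = (η : ℤ) • star (φ y x) := by
  rcases Int.units_eq_one_or η with rfl | rfl <;> simp [T]

theorem symmetrize_swap (θ : Q Λ η M) (x y : M) :
    symmetrize η θ x y = (η : ℤ) • star (symmetrize η θ y x) := by
  obtain ⟨ψ, rfl⟩ := Q.exists_mk θ
  simp only [symmetrize_mk, LinearMap.add_apply, Dual.add_apply, T_apply, star_add, star_smul,
    star_star, smul_add, smul_smul, star_trivial, coe_unit_mul_self, one_smul]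
  exact add_comm _ _

theorem Q.mk_T (φ : M →ₗ[Λ] Dual Λ M) : Q.mk η (T η φ) = Q.mk η φ := by
  have h := Q.mk_add η (φ - T η φ) (T η φ)
  rw [Q.mk_sub_T, zero_add, sub_add_cancel] at h
  exact h.symm

theorem Q.mk_neg (φ : M →ₗ[Λ] Dual Λ M) : Q.mk η (-φ) = -Q.mk η φ := rfl

/-- The class of `(f + g)* θ (f + g)` in terms of `f* θ f`, `g* θ g` and the symmetrization. -/
theorem pull_add_map (f g : M →ₗ[Λ] N) (θ : Q Λ η N) :
    pull (f + g) θ = pull f θ + pull g θ + Q.mk η (dualMap g ∘ₗ symmetrize η θ ∘ₗ f) := by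
  obtain ⟨ψ, rfl⟩ := Q.exists_mk θ
  -- One of the two cross terms of `ψ`. It may be replaced by `T η B`, which has the same class;
  -- together with the other cross term this makes up the symmetrization.
  let B : M →ₗ[Λ] Dual Λ M := dualMap f ∘ₗ ψ ∘ₗ g
  have h1 : pullHom (f + g) ψ =
      pullHom f ψ + pullHom g ψ + (dualMap g ∘ₗ ψ ∘ₗ f + B) := by
    ext x y
    simp only [pullHom_apply, LinearMap.add_apply, map_add, Dual.add_apply, LinearMap.comp_apply,
      dualMap_apply, B]
    abel
  have h2 : dualMap g ∘ₗ symmetrize η (Q.mk η ψ) ∘ₗ f = dualMap g ∘ₗ ψ ∘ₗ f + T η B := by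
    ext x y
    simp only [symmetrize_mk, LinearMap.add_apply, map_add, Dual.add_apply, LinearMap.comp_apply,
      dualMap_apply, B, T_apply]
  rw [pull_mk, pull_mk, pull_mk, h1, h2, Q.mk_add, Q.mk_add, Q.mk_add, Q.mk_add, Q.mk_T]

end QLemmas

/-! ### Non-singular and hyperbolic forms; boundaries as formations -/

namespace QForm

variable {Λ : Type u} [Ring Λ] [StarRing Λ] {η ε : ℤˣ}

theorem bilin_swap (X : QForm Λ η) (x y : X.K) :
    X.bilin x y = (η : ℤ) • star (X.bilin y x) :=
  symmetrize_swap X.form x y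

theorem bilin_sum (X Y : QForm Λ η) : (X.sum Y).bilin = dualSum X.bilin Y.bilin :=
  symmetrize_qSum _ _

theorem bilin_hyperbolic (P : Type u) [AddCommGroup P] [Module Λ P] [Module.Free Λ P]
    [Module.Finite Λ P] (u v : P × Dual Λ P) :
    (hyperbolic Λ η P).bilin u v = u.2 v.1 + (η : ℤ) • star (v.2 u.1) := by
  have h : ((hyperbolic Λ η P).bilin : P × Dual Λ P →ₗ[Λ] Dual Λ (P × Dual Λ P)) =
    (dualMap (LinearMap.fst Λ P (Dual Λ P)) ∘ₗ LinearMap.snd Λ P (Dual Λ P)) +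
      T η (dualMap (LinearMap.fst Λ P (Dual Λ P)) ∘ₗ LinearMap.snd Λ P (Dual Λ P)) := rfl
  refine (congrArg (fun φ : P × Dual Λ P →ₗ[Λ] Dual Λ (P × Dual Λ P) => φ u v) h).trans ?_
  simp only [LinearMap.add_apply, Dual.add_apply, T_apply, LinearMap.comp_apply, dualMap_apply,
    LinearMap.fst_apply, LinearMap.snd_apply]

theorem Nonsingular.of_sum_left {X Y : QForm Λ η} (h : (X.sum Y).Nonsingular) :
    X.Nonsingular := by
  rw [Nonsingular, bilin_sum] at h
  have h' : Function.Bijective (dualProd ∘ Prod.map X.bilin Y.bilin) := h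
  rw [Function.Bijective.of_comp_iff' dualProd.bijective] at h'
  exact (Prod.map_bijective.1 h').1

theorem Nonsingular.congr {X Y : QForm Λ η} (hXY : X.Isometric Y) (hX : X.Nonsingular) :
    Y.Nonsingular := by
  obtain ⟨f, hf⟩ := hXY
  have h : X.bilin = pullHom f.toLinearMap Y.bilin := by
    rw [bilin, ← hf]
    exact symmetrize_pull _ _
  have h' : ⇑Y.bilin = invDual f ∘ X.bilin ∘ f.symm := by
    funext y
    refine Dual.ext fun v => ?_
    simp [h]
  rw [Nonsingular, h']
  exact (invDual f).bijective.comp (hX.comp f.symm.bijective)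

theorem nonsingular_hyperbolic (P : Type u) [AddCommGroup P] [Module Λ P] [Module.Free Λ P]
    [Module.Finite Λ P] : (hyperbolic Λ η P).Nonsingular := by
  have hη : ∀ a : Λ, (η : ℤ) • (η : ℤ) • a = a := fun a => by
    rw [smul_smul, coe_unit_mul_self, one_smul]
  constructor
  · rw [injective_iff_map_eq_zero]
    rintro ⟨p, f⟩ h
    have h' : ∀ v : P × Dual Λ P, f v.1 + (η : ℤ) • star (v.2 p) = 0 := fun v => by
      
      exact (bilin_hyperbolic (Λ := Λ) (η := η) P (p, f) v).symm.trans
        (congrArg (fun φ : Dual Λ (P × Dual Λ P) => φ v) h)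
    have hf : f = 0 := Dual.ext fun x => by simpa using h' (x, 0)
    have hp : p = 0 := by
      refine (ev_bijective (Λ := Λ) (M := P)).1 (Dual.ext fun g => ?_)
      have := h' (0, g)
      rw [map_zero, zero_add] at this
      rw [ev_apply, ← hη (star (g p)), this, smul_zero, map_zero, Dual.zero_apply]
    exact Prod.ext hp hf
  · intro F
    obtain ⟨⟨f, G⟩, rfl⟩ := dualProd.surjective F
    obtain ⟨p, rfl⟩ := ev_bijective.2 G
    refine ⟨((η : ℤ) • p, f), Dual.ext fun v => ?_⟩
    refine (bilin_hyperbolic P ((η : ℤ) • p, f) v).trans ?_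
    change f v.1 + (η : ℤ) • star (v.2 ((η : ℤ) • p)) = f v.1 + star (v.2 p)
    rw [map_zsmul, star_smul, star_trivial, hη]

/-- The sign is absorbed by `-1` on the factor `P*`. -/
theorem neg_hyperbolic_isometric (P : Type u) [AddCommGroup P] [Module Λ P] [Module.Free Λ P]
    [Module.Finite Λ P] : (hyperbolic Λ η P).neg.Isometric (hyperbolic Λ η P) := by
  let e : (P × Dual Λ P) ≃ₗ[Λ] P × Dual Λ P :=
    (LinearEquiv.refl Λ P).prodCongr (LinearEquiv.neg Λ)
  refine ⟨e, ?_⟩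
  let φ : P × Dual Λ P →ₗ[Λ] Dual Λ (P × Dual Λ P) :=
    dualMap (LinearMap.fst Λ P (Dual Λ P)) ∘ₗ LinearMap.snd Λ P (Dual Λ P)
  have h : pullHom e.toLinearMap φ = -φ := LinearMap.ext fun u => Dual.ext fun v => rfl
  change pull e.toLinearMap (Q.mk η φ) = -Q.mk η φ
  exact (congrArg (Q.mk η) h).trans (Q.mk_neg φ)

theorem neg_sum (X Y : QForm Λ η) : X.neg.sum Y.neg = (X.sum Y).neg := by
  have h : qSum (-X.form) (-Y.form) = -qSum X.form Y.form := by
    rw [qSum, qSum, map_neg, map_neg, neg_add]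
  exact congrArg (fun q : Q Λ η (X.K × Y.K) => (⟨X.K × Y.K, q⟩ : QForm Λ η)) h

theorem hyperbolic_congr {P P' : Type u} [AddCommGroup P] [Module Λ P] [Module.Free Λ P]
    [Module.Finite Λ P] [AddCommGroup P'] [Module Λ P'] [Module.Free Λ P']
    [Module.Finite Λ P'] (e : P ≃ₗ[Λ] P') :
    (hyperbolic Λ η P).Isometric (hyperbolic Λ η P') := by
  refine ⟨e.prodCongr (invDual e), ?_⟩
  refine congrArg (Q.mk η (M := P × Dual Λ P)) ?_
  refine LinearMap.ext fun u => Dual.ext fun v => ?_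
  change u.2 (e.symm (e v.1)) = u.2 v.1
  rw [e.symm_apply_apply]

/-- The boundary of a sum of forms is the sum of the boundaries. -/
theorem boundary_sum_eq (X Y : QForm Λ (-ε)) :
    X.boundary.sum Y.boundary = (X.sum Y).boundary := by
  -- The two preformations differ only in `μ`, where they agree by `bilin_sum` but not by
  -- definition. With `μ` generalized to `b` the equality can be substituted. Having an equality and
  -- not just an isomorphism lets flip-isomorphisms be transported by rewriting.
  have h : ∀ (b : X.K × Y.K →ₗ[Λ] Dual Λ (X.K × Y.K)) (hb : (X.sum Y).bilin = b)
      (hs : symmetrize (-ε) (qSum X.form Y.form) = dualMap LinearMap.id ∘ₗ b),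
      (⟨X.K × Y.K, X.K × Y.K, LinearMap.id, b, qSum X.form Y.form, hs⟩ : Preformation Λ ε) =
        (X.sum Y).boundary := by
    rintro _ rfl _
    rfl
  exact h _ (bilin_sum X Y) _

/-- The boundary of a quadratic form is a non-singular formation. -/
theorem boundary_isNonsingularFormation (X : QForm Λ (-ε)) :
    X.boundary.IsNonsingularFormation := by
  let g : X.K →ₗ[Λ] X.K × Dual Λ X.K := LinearMap.id.prod X.bilin
  let H : QForm Λ ε := hyperbolic Λ ε X.K
  let R : Submodule Λ (X.K × Dual Λ X.K) := LinearMap.range g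
  refine ⟨fun x y h => congrArg Prod.fst h, ?_, ?_, ?_⟩
  · refine ⟨LinearMap.range (LinearMap.inr Λ X.K (Dual Λ X.K)), IsCompl.of_eq ?_ ?_⟩
    · refine (Submodule.eq_bot_iff _).2 ?_
      rintro _ ⟨⟨x, rfl⟩, ⟨f, hf⟩⟩
      have h : (0 : X.K) = x := congrArg Prod.fst hf
      rw [← h]
      exact map_zero g
    · refine Submodule.eq_top_iff'.2 ?_
      rintro ⟨(x : X.K), (f : Dual Λ X.K)⟩
      refine Submodule.mem_sup.2 ⟨g x, ⟨x, rfl⟩, (0, f - X.bilin x), ⟨_, rfl⟩, ?_⟩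
      exact Prod.ext (add_zero x) (add_sub_cancel _ _)
  · obtain ⟨ψ, hψ⟩ := Q.exists_mk X.form
    let p : R →ₗ[Λ] X.K := LinearMap.fst Λ _ _ ∘ₗ R.subtype
    have hp : ∀ r : R, (r : X.K × Dual Λ X.K).2 = X.bilin (p r) := by
      rintro ⟨_, x, rfl⟩
      rfl
    let φ : X.K × Dual Λ X.K →ₗ[Λ] Dual Λ (X.K × Dual Λ X.K) :=
      dualMap (LinearMap.fst Λ X.K (Dual Λ X.K)) ∘ₗ LinearMap.snd Λ X.K (Dual Λ X.K)
    -- On the graph the hyperbolic form restricts to `λ = ψ - εψ* = (1 - T_ε)ψ`, which is zero in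
    -- `Q_ε`.
    suffices h : pullHom R.subtype φ = pullHom p ψ - T ε (pullHom p ψ) from
      (congrArg (Q.mk ε) h).trans (Q.mk_sub_T ε (pullHom p ψ))
    refine LinearMap.ext fun r => Dual.ext fun s => ?_
    change (r : X.K × Dual Λ X.K).2 (s : X.K × Dual Λ X.K).1 = _
    have hb : X.bilin = ψ + T (-ε) ψ := by rw [bilin, ← hψ, symmetrize_mk]
    rw [hp, hb]
    simp only [LinearMap.add_apply, LinearMap.sub_apply, Dual.add_apply, Dual.sub_apply, T_apply,
      pullHom_apply, Units.val_neg, neg_smul]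
    rw [← sub_eq_add_neg]
    rfl
  · refine Submodule.ext ?_
    rintro ⟨(x : X.K), (f : Dual Λ X.K)⟩
    -- The pairing of `(x, f)` with the point of the graph over `y`. It vanishes for all `y` exactly
    -- when `f = λ x`, so the graph is its own orthogonal.
    have e : ∀ y : X.K, f y + (ε : ℤ) • star (X.bilin y x) = f y - X.bilin x y := fun y => by
      rw [X.bilin_swap x y, Units.val_neg, neg_smul, sub_neg_eq_add]
    constructor
    · rintro ⟨w, hw⟩
      have h1 : w = x := congrArg Prod.fst hw
      have h2 : X.bilin w = f := congrArg Prod.snd hw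
      subst h1
      refine LinearMap.mem_ker.2 (Dual.ext ?_)
      rintro ⟨_, y, rfl⟩
      refine (bilin_hyperbolic X.K (w, f) (g y)).trans ((e y).trans ?_)
      rw [h2, sub_self, Dual.zero_apply]
    · intro h
      refine ⟨x, Prod.ext rfl (Dual.ext fun y => ?_)⟩
      have h2 : dualMap R.subtype (H.bilin (x, f)) = 0 := h
      have h3 := congrArg (fun φ : Dual Λ R => φ ⟨g y, y, rfl⟩) h2
      have h4 := (bilin_hyperbolic (η := ε) X.K (x, f) (g y)).symm.trans h3
      exact (sub_eq_zero.1 ((e y).symm.trans h4)).symm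

end QForm

/-! ### Direct summands and retractions -/

section Retractions

variable {Λ : Type u} [Ring Λ] {W F : Type u} [AddCommGroup W] [Module Λ W]
  [AddCommGroup F] [Module Λ F]

theorem isCompl_range_ker_of_retraction (f : W →ₗ[Λ] F) (r : F →ₗ[Λ] W)
    (h : r ∘ₗ f = LinearMap.id) : IsCompl (LinearMap.range f) (LinearMap.ker r) := by
  have hr : ∀ w, r (f w) = w := fun w => LinearMap.congr_fun h w
  refine IsCompl.of_eq ?_ ?_
  · refine (Submodule.eq_bot_iff _).2 ?_
    rintro _ ⟨⟨w, rfl⟩, hw⟩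
    have hw' : r (f w) = 0 := hw
    rw [hr] at hw'
    rw [hw', map_zero]
  · refine Submodule.eq_top_iff'.2 fun x => ?_
    refine Submodule.mem_sup.2 ⟨f (r x), ⟨_, rfl⟩, x - f (r x), ?_, add_sub_cancel _ _⟩
    rw [LinearMap.mem_ker, map_sub, hr, sub_self]

theorem exists_isCompl_of_retraction (f : W →ₗ[Λ] F) (r : F →ₗ[Λ] W)
    (h : r ∘ₗ f = LinearMap.id) : ∃ C, IsCompl (LinearMap.range f) C :=
  ⟨_, isCompl_range_ker_of_retraction f r h⟩

theorem exists_retraction_of_isCompl (f : W →ₗ[Λ] F) (hf : Function.Injective f)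
    {C : Submodule Λ F} (hC : IsCompl (LinearMap.range f) C) :
    ∃ r : F →ₗ[Λ] W, r ∘ₗ f = LinearMap.id := by
  let p := Submodule.projectionOnto _ _ hC
  let e := LinearEquiv.ofInjective f hf
  refine ⟨e.symm.toLinearMap ∘ₗ p, LinearMap.ext fun w => ?_⟩
  have hp : p (f w) = e w := Submodule.projectionOnto_apply_left hC (e w)
  rw [LinearMap.comp_apply, LinearMap.comp_apply, hp]
  exact e.symm_apply_apply w

end Retractions

/-! ### Elementary preformations via parametrized h-lagrangians -/

namespace Preformation

variable {Λ : Type u} [Ring Λ] [StarRing Λ] {ε : ℤˣ}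

/-- A parametrized `h`-lagrangian: a map `j : W → G` from a finitely generated free module whose
image is an `h`-lagrangian. -/
structure IsHLagrangianMap (z : Preformation Λ ε) {W : Type u} [AddCommGroup W] [Module Λ W]
    (j : W →ₗ[Λ] z.G) : Prop where
  bilin : ∀ x y, z.μ (j x) (z.γ (j y)) = 0
  form : pull j z.θ = 0
  retraction_γ : ∃ r : z.F →ₗ[Λ] W, r ∘ₗ z.γ ∘ₗ j = LinearMap.id
  retraction_μ : ∃ r : Dual Λ z.F →ₗ[Λ] W, r ∘ₗ z.μ ∘ₗ j = LinearMap.id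
  exact : ∀ f : Dual Λ z.F, (∀ w, f (z.γ (j w)) = 0) → ∃ w, z.μ (j w) = f

theorem IsHLagrangian.isHLagrangianMap {z : Preformation Λ ε} {U : Submodule Λ z.G}
    (h : z.IsHLagrangian U) : z.IsHLagrangianMap U.subtype where
  bilin x y := h.bilin_eq_zero x x.2 y y.2
  form := h.form_eq_zero
  retraction_γ := by
    obtain ⟨C, hC⟩ := h.summand_γ
    rw [← U.range_subtype, ← LinearMap.range_comp] at hC
    exact exists_retraction_of_isCompl _ h.injective_γ hC
  retraction_μ := by
    obtain ⟨C, hC⟩ := h.summand_μ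
    rw [← U.range_subtype, ← LinearMap.range_comp] at hC
    exact exists_retraction_of_isCompl _ h.injective_μ hC
  exact f hf := by
    have hf' : f ∈ LinearMap.ker (dualMap (U.map z.γ).subtype) := by
      refine LinearMap.mem_ker.2 (Dual.ext ?_)
      rintro ⟨_, x, hx, rfl⟩
      exact hf ⟨x, hx⟩
    rw [h.restrict_ker] at hf'
    obtain ⟨x, hx, rfl⟩ := hf'
    exact ⟨⟨x, hx⟩, rfl⟩

/-- The surjectivity of restriction to `U₀` need not be assumed: a retraction of `γ j` extends
functionals from `U₀` to `F`. -/
theorem IsHLagrangianMap.isElementary {z : Preformation Λ ε} {W : Type u} [AddCommGroup W]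
    [Module Λ W] [Module.Free Λ W] [Module.Finite Λ W] {j : W →ₗ[Λ] z.G}
    (h : z.IsHLagrangianMap j) : z.IsElementary := by
  obtain ⟨r, hr⟩ := h.retraction_γ
  obtain ⟨s, hs⟩ := h.retraction_μ
  have hr' : ∀ w, r (z.γ (j w)) = w := fun w => LinearMap.congr_fun hr w
  have hs' : ∀ w, s (z.μ (j w)) = w := fun w => LinearMap.congr_fun hs w
  have hj : Function.Injective j := fun x y hxy => by rw [← hr' x, hxy, hr']
  let e : W ≃ₗ[Λ] LinearMap.range j := LinearEquiv.ofInjective j hj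
  have hγ : (LinearMap.range j).map z.γ = LinearMap.range (z.γ ∘ₗ j) :=
    (LinearMap.range_comp _ _).symm
  have hμ : (LinearMap.range j).map z.μ = LinearMap.range (z.μ ∘ₗ j) :=
    (LinearMap.range_comp _ _).symm
  refine ⟨LinearMap.range j, Module.Free.of_equiv e, Module.Finite.equiv e, ?_, ?_, ?_, ?_, ?_,
    ?_, ?_, ?_⟩
  · rintro _ ⟨x, rfl⟩ _ ⟨y, rfl⟩
    exact h.bilin x y
  · have : (LinearMap.range j).subtype = j ∘ₗ e.symm.toLinearMap := by
      refine LinearMap.ext fun x => ?_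
      obtain ⟨w, rfl⟩ := e.surjective x
      rw [LinearMap.comp_apply, LinearEquiv.coe_coe, e.symm_apply_apply]
      rfl
    rw [this, ← pull_pull, h.form, map_zero]
  · rintro ⟨_, x, rfl⟩ ⟨_, y, rfl⟩ hxy
    have hxy' : z.γ (j x) = z.γ (j y) := hxy
    have : x = y := by rw [← hr' x, hxy', hr']
    rw [this]
  · rintro ⟨_, x, rfl⟩ ⟨_, y, rfl⟩ hxy
    have hxy' : z.μ (j x) = z.μ (j y) := hxy
    have : x = y := by rw [← hs' x, hxy', hs']
    rw [this]
  · rw [hγ]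
    exact exists_isCompl_of_retraction _ r hr
  · rw [hμ]
    exact exists_isCompl_of_retraction _ s hs
  · refine Submodule.ext fun f => ⟨fun hf => ?_, ?_⟩
    · obtain ⟨w, rfl⟩ := h.exact f fun w =>
        congrArg (fun g : Dual Λ ((LinearMap.range j).map z.γ) => g ⟨z.γ (j w), j w, ⟨w, rfl⟩, rfl⟩)
          (LinearMap.mem_ker.1 hf)
      exact ⟨j w, ⟨w, rfl⟩, rfl⟩
    · rintro ⟨_, ⟨w, rfl⟩, rfl⟩
      refine LinearMap.mem_ker.2 (Dual.ext ?_)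
      rintro ⟨_, _, ⟨v, rfl⟩, rfl⟩
      exact h.bilin w v
  · intro g
    -- Projection of `F` onto `U₀`; composing a functional on `U₀` with it gives the extension.
    let q : z.F →ₗ[Λ] (LinearMap.range j).map z.γ :=
      LinearMap.codRestrict _ (z.γ ∘ₗ j ∘ₗ r) fun x => ⟨_, ⟨_, rfl⟩, rfl⟩
    refine ⟨dualMap q g, Dual.ext ?_⟩
    rintro ⟨_, _, ⟨v, rfl⟩, rfl⟩
    refine congrArg g (Subtype.ext ?_)
    exact congrArg (fun x => z.γ (j x)) (hr' v)

theorem isElementary_iff (z : Preformation Λ ε) : z.IsElementary ↔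
    ∃ (W : Type u) (_ : AddCommGroup W) (_ : Module Λ W) (_ : Module.Free Λ W)
      (_ : Module.Finite Λ W) (j : W →ₗ[Λ] z.G), z.IsHLagrangianMap j := by
  constructor
  · rintro ⟨U, hU⟩
    exact ⟨U, inferInstance, inferInstance, hU.free, hU.finite, U.subtype, hU.isHLagrangianMap⟩
  · rintro ⟨W, _, _, _, _, j, hj⟩
    exact hj.isElementary

theorem IsHLagrangianMap.sum {z z' : Preformation Λ ε} {W W' : Type u} [AddCommGroup W]
    [Module Λ W] [AddCommGroup W'] [Module Λ W'] {j : W →ₗ[Λ] z.G} {j' : W' →ₗ[Λ] z'.G}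
    (h : z.IsHLagrangianMap j) (h' : z'.IsHLagrangianMap j') :
    (z.sum z').IsHLagrangianMap (j.prodMap j') where
  bilin x y := by
    change z.μ (j x.1) (z.γ (j y.1)) + z'.μ (j' x.2) (z'.γ (j' y.2)) = 0
    rw [h.bilin, h'.bilin, add_zero]
  form := by
    refine (pull_qSum _ _ _).trans ?_
    have e : pull (j ∘ₗ LinearMap.fst Λ W W') z.θ + pull (j' ∘ₗ LinearMap.snd Λ W W') z'.θ = 0 := by
      rw [← pull_pull, ← pull_pull, h.form, h'.form, map_zero, map_zero, add_zero]
    exact e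
  retraction_γ := by
    obtain ⟨r, hr⟩ := h.retraction_γ
    obtain ⟨r', hr'⟩ := h'.retraction_γ
    refine ⟨r.prodMap r', LinearMap.ext fun w => Prod.ext ?_ ?_⟩
    · exact LinearMap.congr_fun hr w.1
    · exact LinearMap.congr_fun hr' w.2
  retraction_μ := by
    obtain ⟨r, hr⟩ := h.retraction_μ
    obtain ⟨r', hr'⟩ := h'.retraction_μ
    refine ⟨r.prodMap r' ∘ₗ (dualProd (Λ := Λ) (M := z.F) (N := z'.F)).symm.toLinearMap,
      LinearMap.ext fun w => ?_⟩
    have e : (r.prodMap r') ((dualProd (Λ := Λ) (M := z.F) (N := z'.F)).symm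
        (dualProd (z.μ (j w.1), z'.μ (j' w.2)))) = w := by
      rw [LinearEquiv.symm_apply_apply]
      exact Prod.ext (LinearMap.congr_fun hr w.1) (LinearMap.congr_fun hr' w.2)
    exact e
  exact f hf := by
    obtain ⟨⟨f₁, f₂⟩, rfl⟩ := (dualProd (Λ := Λ) (M := z.F) (N := z'.F)).surjective f
    have hf' : ∀ w w', f₁ (z.γ (j w)) + f₂ (z'.γ (j' w')) = 0 := fun w w' => hf (w, w')
    obtain ⟨w, hw⟩ := h.exact f₁ fun w => by simpa using hf' w 0
    obtain ⟨w', hw'⟩ := h'.exact f₂ fun w => by simpa using hf' 0 w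
    refine ⟨(w, w'), ?_⟩
    rw [← hw, ← hw']
    rfl

theorem IsElementary.sum {z z' : Preformation Λ ε} (h : z.IsElementary) (h' : z'.IsElementary) :
    (z.sum z').IsElementary := by
  obtain ⟨W, _, _, _, _, j, hj⟩ := (isElementary_iff z).1 h
  obtain ⟨W', _, _, _, _, j', hj'⟩ := (isElementary_iff z').1 h'
  exact (hj.sum hj').isElementary

theorem IsElementary.congr {z z' : Preformation Λ ε} (e : StrongIso z z') (h : z.IsElementary) :
    z'.IsElementary := by
  obtain ⟨W, _, _, _, _, j, hj⟩ := (isElementary_iff z).1 h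
  obtain ⟨α, β, h1, h2, h3⟩ := e
  have h1' : ∀ x, z'.γ (β x) = α (z.γ x) := fun x => (LinearMap.congr_fun h1 x).symm
  have h2' : ∀ x, z'.μ (β x) = invDual α (z.μ x) := fun x => (LinearMap.congr_fun h2 x).symm
  refine IsHLagrangianMap.isElementary (j := β.toLinearMap ∘ₗ j) ⟨?_, ?_, ?_, ?_, ?_⟩
  · intro x y
    simp only [LinearMap.comp_apply, LinearEquiv.coe_coe, h1', h2', invDual_apply,
      LinearEquiv.symm_apply_apply]
    exact hj.bilin x y
  · rw [← pull_pull, ← h3, hj.form]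
  · obtain ⟨r, hr⟩ := hj.retraction_γ
    refine ⟨r ∘ₗ α.symm.toLinearMap, LinearMap.ext fun w => ?_⟩
    simp only [LinearMap.comp_apply, LinearEquiv.coe_coe, h1', LinearEquiv.symm_apply_apply]
    exact LinearMap.congr_fun hr w
  · obtain ⟨r, hr⟩ := hj.retraction_μ
    refine ⟨r ∘ₗ (invDual α).symm.toLinearMap, LinearMap.ext fun w => ?_⟩
    simp only [LinearMap.comp_apply, LinearEquiv.coe_coe, h2', LinearEquiv.symm_apply_apply]
    exact LinearMap.congr_fun hr w
  · intro f hf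
    obtain ⟨w, hw⟩ := hj.exact ((invDual α).symm f) fun w => by
      rw [← hf w, LinearMap.comp_apply, LinearEquiv.coe_coe, h1']
      rfl
    refine ⟨w, ?_⟩
    rw [LinearMap.comp_apply, LinearEquiv.coe_coe, h2', hw, LinearEquiv.apply_symm_apply]

end Preformation

/-! ### Forms with elementary boundary are hyperbolic -/

namespace QForm

open Preformation

variable {Λ : Type u} [Ring Λ] [StarRing Λ] {ε η : ℤˣ}

/-- The summand `P` is an h-lagrangian: the form vanishes on it, and `λ` maps it, as `-ε` times
evaluation, onto `P**`, the annihilator of `P` in `(P ⊕ P*)*`. -/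
theorem isElementary_boundary_hyperbolic (P : Type u) [AddCommGroup P] [Module Λ P]
    [Module.Free Λ P] [Module.Finite Λ P] :
    (hyperbolic Λ (-ε) P).boundary.IsElementary := by
  have hb : ∀ (p : P) (v : P × Dual Λ P), (hyperbolic Λ (-ε) P).bilin (p, (0 : Dual Λ P)) v =
      ((-ε : ℤˣ) : ℤ) • star (v.2 p) := fun p v =>
    (bilin_hyperbolic P (p, 0) v).trans (zero_add _)
  have hη : ∀ a : Λ, ((-ε : ℤˣ) : ℤ) • ((-ε : ℤˣ) : ℤ) • a = a := fun a => by
    rw [smul_smul, coe_unit_mul_self, one_smul]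
  refine IsHLagrangianMap.isElementary (W := P) (j := LinearMap.inl Λ P (Dual Λ P))
    ⟨?_, ?_, ⟨LinearMap.fst Λ P (Dual Λ P), rfl⟩, ?_, ?_⟩
  · intro x y
    refine (hb x (y, 0)).trans ?_
    change ((-ε : ℤˣ) : ℤ) • star (0 : Λ) = 0
    rw [star_zero, smul_zero]
  · have h : pullHom (LinearMap.inl Λ P (Dual Λ P))
        (dualMap (LinearMap.fst Λ P (Dual Λ P)) ∘ₗ LinearMap.snd Λ P (Dual Λ P)) = 0 := rfl
    exact congrArg (Q.mk (-ε)) h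
  · let r : Dual Λ (P × Dual Λ P) →ₗ[Λ] P := ((-ε : ℤˣ) : ℤ) •
      (evEquiv.symm.toLinearMap ∘ₗ dualMap (LinearMap.inr Λ P (Dual Λ P)))
    refine ⟨r, LinearMap.ext fun p => ?_⟩
    have h : dualMap (LinearMap.inr Λ P (Dual Λ P))
        ((hyperbolic Λ (-ε) P).bilin (p, (0 : Dual Λ P))) = ((-ε : ℤˣ) : ℤ) • ev p := by
      refine Dual.ext fun f => (hb p (0, f)).trans ?_
      rcases Int.units_eq_one_or (-ε) with h | h <;> simp [h]
    change ((-ε : ℤˣ) : ℤ) • evEquiv.symm (dualMap (LinearMap.inr Λ P (Dual Λ P))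
        ((hyperbolic Λ (-ε) P).bilin (p, (0 : Dual Λ P)))) = p
    rw [h, map_zsmul, smul_smul, coe_unit_mul_self, one_smul]
    exact evEquiv.symm_apply_apply p
  · intro f hf
    obtain ⟨⟨f₁, f₂⟩, rfl⟩ := (dualProd (Λ := Λ) (M := P) (N := Dual Λ P)).surjective f
    obtain ⟨p, rfl⟩ := ev_bijective.2 f₂
    refine ⟨((-ε : ℤˣ) : ℤ) • p, Dual.ext fun v => (hb _ v).trans ?_⟩
    have h1 : f₁ v.1 + 0 = 0 := (congrArg (f₁ v.1 + ·) (map_zero (ev p)).symm).trans (hf v.1)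
    rw [add_zero] at h1
    have h2 : ∀ g : Dual Λ P, ((-ε : ℤˣ) : ℤ) • star (g (((-ε : ℤˣ) : ℤ) • p)) = star (g p) :=
      fun g => by rw [map_zsmul, star_smul, star_trivial, hη]
    change _ = f₁ v.1 + star (v.2 p)
    rw [h1, zero_add]
    exact h2 v.2

/-- A form whose boundary is elementary is a hyperbolic form. -/
theorem exists_isometric_hyperbolic (X : QForm Λ (-ε)) (h : X.boundary.IsElementary) :
    ∃ (P : Type u) (_ : AddCommGroup P) (_ : Module Λ P) (_ : Module.Free Λ P)
      (_ : Module.Finite Λ P), (hyperbolic Λ (-ε) P).Isometric X := by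
  obtain ⟨W, _, _, _, _, j, hj⟩ := (isElementary_iff _).1 h
  have hη : ∀ a : Λ, ((-ε : ℤˣ) : ℤ) • ((-ε : ℤˣ) : ℤ) • a = a := fun a => by
    rw [smul_smul, coe_unit_mul_self, one_smul]
  let j : W →ₗ[Λ] X.K := j
  obtain ⟨r, hr⟩ : ∃ r : X.K →ₗ[Λ] W, r ∘ₗ j = LinearMap.id := hj.retraction_γ
  obtain ⟨t, ht⟩ : ∃ t : Dual Λ X.K →ₗ[Λ] W, t ∘ₗ X.bilin ∘ₗ j = LinearMap.id := hj.retraction_μ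
  have hr' : ∀ w, r (j w) = w := fun w => LinearMap.congr_fun hr w
  have ht' : ∀ w, t (X.bilin (j w)) = w := fun w => LinearMap.congr_fun ht w
  have hex : ∀ f : Dual Λ X.K, (∀ w, f (j w) = 0) → ∃ w, X.bilin (j w) = f := hj.exact
  have hbil : ∀ x y, X.bilin (j x) (j y) = 0 := hj.bilin
  have hform : pull j X.form = 0 := hj.form
  -- the functionals on `W` are represented by elements of `K`
  let p : X.K →ₗ[Λ] Dual Λ W := dualMap j ∘ₗ X.bilin
  have hp : Function.Surjective p := by
    intro g
    -- Projection of `K*` onto the annihilator of `j W`. By exactness this annihilator is `λ (j W)`,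
    -- which `t` identifies with `W`.
    let π : Dual Λ X.K →ₗ[Λ] Dual Λ X.K := LinearMap.id - dualMap r ∘ₗ dualMap j
    have hπ : ∀ f w, π f (j w) = 0 := fun f w => by simp [π, hr']
    have hπ' : ∀ f, (∀ w, f (j w) = 0) → π f = f := fun f hf => by
      have : dualMap j f = 0 := Dual.ext hf
      simp [π, this]
    have hρ : ∀ f, X.bilin (j (t (π f))) = π f := fun f => by
      obtain ⟨w, hw⟩ := hex (π f) (hπ f)
      rw [← hw, ht']
    -- The functional `g` on `W`, transported to `λ (j W)` and extended to `K*`. Reflexivity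
    -- represents it by some `c` in `K`, and `-ε c` is then a preimage of `g`. Invertibility of `λ`
    -- is not available at this point.
    let G : Dual Λ (Dual Λ X.K) := dualMap (t ∘ₗ π) g
    obtain ⟨c, hc⟩ := ev_bijective.2 G
    refine ⟨((-ε : ℤˣ) : ℤ) • c, Dual.ext fun w => ?_⟩
    have h1 : star (X.bilin (j w) c) = g (t (π (X.bilin (j w)))) :=
      congrArg (fun φ : Dual Λ (Dual Λ X.K) => φ (X.bilin (j w))) hc
    rw [hπ' _ (hbil w), ht'] at h1
    rw [map_zsmul, ← h1]
    change (((-ε : ℤˣ) : ℤ) • dualMap j (X.bilin c)) w = _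
    have h2 : (((-ε : ℤˣ) : ℤ) • dualMap j (X.bilin c)) w =
        ((-ε : ℤˣ) : ℤ) • X.bilin c (j w) := by
      rcases Int.units_eq_one_or (-ε) with h | h <;> simp [h]
    rw [h2, X.bilin_swap c, hη]
  have hker : ∀ x, p x = 0 → ∃ w, j w = x := by
    intro x hx
    obtain ⟨w, hw⟩ := hex (X.bilin x) fun w => congrArg (fun φ : Dual Λ W => φ w) hx
    -- The radical of `λ` lies in `j W`: every functional of `y - j (r y)` is the value at `y` of
    -- some `λ (j v)`, and so vanishes. This handles the ambiguity in solving `λ x = λ (j w)`.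
    have hker0 : ∀ y, X.bilin y = 0 → ∃ v, j v = y := by
      intro y hy
      refine ⟨r y, (sub_eq_zero.1 (ev_bijective.1 ((Dual.ext fun f => ?_ :
        ev (y - j (r y)) = (0 : Dual Λ (Dual Λ X.K))).trans (map_zero _).symm))).symm⟩
      let f' : Dual Λ X.K := f - dualMap r (dualMap j f)
      have e : f (y - j (r y)) = f' y := by simp [f']
      obtain ⟨v, hv⟩ := hex f' fun w => by simp [f', hr']
      rw [ev_apply, e, ← hv, X.bilin_swap, hy]
      simp
    have hd : X.bilin (x - j w) = 0 := by rw [map_sub, hw, sub_self]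
    obtain ⟨v, hv⟩ := hker0 _ hd
    exact ⟨v + w, by rw [map_add, hv, sub_add_cancel]⟩
  obtain ⟨s, hs⟩ := LinearMap.exists_rightInverse_of_surjective p (LinearMap.range_eq_top.2 hp)
  have hs' : ∀ f w, X.bilin (s f) (j w) = f w := fun f w =>
    congrArg (fun φ : Dual Λ W => φ w) (LinearMap.congr_fun hs f)
  -- The section `s` of `p` need not have isotropic image. Adding `j k` changes the pulled-back
  -- class by the cross term `f(k f')`, so `k` is chosen to make this `-κ`.
  obtain ⟨κ, hκ⟩ := Q.exists_mk (pull s X.form)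
  let k : Dual Λ W →ₗ[Λ] W := -(evEquiv.symm.toLinearMap ∘ₗ adj κ)
  have hk : ∀ f f' : Dual Λ W, f (k f') = -κ f f' := by
    intro f f'
    have h1 : ev (evEquiv.symm (adj κ f')) = adj κ f' := evEquiv.apply_symm_apply _
    have h2 := congrArg (fun φ : Dual Λ (Dual Λ W) => star (φ f)) h1
    simp only [ev_apply, adj_apply, star_star] at h2
    simp [k, h2]
  let s' : Dual Λ W →ₗ[Λ] X.K := s + j ∘ₗ k
  have hs'' : ∀ f w, X.bilin (s' f) (j w) = f w := fun f w => by
    simp [s', hs', hbil]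
  have hform' : pull s' X.form = 0 := by
    rw [pull_add_map, ← pull_pull, hform, map_zero, add_zero, ← hκ, ← Q.mk_add]
    refine congrArg (Q.mk (-ε)) (LinearMap.ext fun f => Dual.ext fun f' => ?_)
    change κ f f' + X.bilin (s f) (j (k f')) = 0
    rw [hs', hk, add_neg_cancel]
  let e : W × Dual Λ W →ₗ[Λ] X.K := s' ∘ₗ LinearMap.snd Λ _ _ + j ∘ₗ LinearMap.fst Λ _ _
  have hpe : ∀ u, p (e u) = u.2 := fun u => Dual.ext fun w => by
    change X.bilin (s' u.2 + j u.1) (j w) = u.2 w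
    rw [map_add, Dual.add_apply, hs'', hbil, add_zero]
  have he : Function.Bijective e := by
    constructor
    · rw [injective_iff_map_eq_zero]
      rintro ⟨w, f⟩ h
      have hf : f = 0 := (hpe (w, f)).symm.trans (by rw [h, map_zero])
      subst hf
      have hw : s' 0 + j w = 0 := h
      rw [map_zero, zero_add] at hw
      rw [← hr' w, hw, map_zero]
      rfl
    · intro x
      obtain ⟨w, hw⟩ := hker (x - e (0, p x)) (by rw [map_sub, hpe, sub_self])
      refine ⟨(w, 0) + (0, p x), ?_⟩
      have h1 : e (w, 0) = j w := by simp [e]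
      rw [map_add, h1, hw, sub_add_cancel]
  refine ⟨W, inferInstance, inferInstance, inferInstance, inferInstance,
    LinearEquiv.ofBijective e he, ?_⟩
  change pull e X.form = Q.mk (-ε) _
  rw [pull_add_map, ← pull_pull, ← pull_pull, hform, hform', map_zero, map_zero, add_zero,
    zero_add]
  refine congrArg (Q.mk (-ε) (M := W × Dual Λ W))
    (LinearMap.ext fun u => Dual.ext fun v => hs'' u.2 v.1)

end QForm

/-! ### Flip-isomorphisms of boundaries -/

namespace QForm

open Preformation

variable {Λ : Type u} [Ring Λ] [StarRing Λ] {ε η : ℤˣ}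

section Flip

variable {X : QForm Λ (-ε)} (t : X.boundary.FlipIso)

/-- The component `α : K → K*` of a flip-isomorphism of `∂(K, θ)`. -/
def flipα : X.K ≃ₗ[Λ] Dual Λ X.K := WeakIso.α t

/-- The component `β : K → K` of a flip-isomorphism of `∂(K, θ)`. -/
def flipβ : X.K ≃ₗ[Λ] X.K := WeakIso.β t

/-- The component `ν ∈ Q_{-ε}(K*)` of a flip-isomorphism of `∂(K, θ)`. -/
def flipν : Q Λ (-ε) (Dual Λ X.K) := WeakIso.ν t

theorem flipα_flipβ (x y : X.K) : flipα t y (flipβ t x) = star (X.bilin x y) := by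
  have h : invDual (flipα t) (X.bilin x) = ev (flipβ t x) := LinearMap.congr_fun t.comm_μ x
  have h' := congrArg (fun φ : Dual Λ (Dual Λ X.K) => φ (flipα t y)) h
  simp only [invDual_apply, LinearEquiv.symm_apply_apply, ev_apply] at h'
  rw [h', star_star]

theorem flipα_sigma (x : X.K) :
    flipα t x + flipα t (sigma (flipν t) (X.bilin x)) = (ε : ℤ) • X.bilin (flipβ t x) :=
  LinearMap.congr_fun t.comm_γ x

theorem form_add_pull_flipν :
    X.form + pull X.bilin (flipν t) = pull (flipβ t).toLinearMap (-X.form) :=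
  t.comm_θ

theorem adj_flipα (x : X.K) : adj (flipα t).toLinearMap (flipβ t x) = X.bilin x :=
  Dual.ext fun y => by
    rw [adj_apply, LinearEquiv.coe_coe, flipα_flipβ, star_star]

/-- The equation `α^{-*} λ = β`, with `K` identified with `K**`, exhibits `λ` as a composite of
isomorphisms. -/
theorem nonsingular_of_flipIso (t : X.boundary.FlipIso) : X.Nonsingular := by
  have h : ⇑X.bilin = (invDual (flipα t)).symm ∘ ev ∘ flipβ t := by
    funext x
    have h : invDual (flipα t) (X.bilin x) = ev (flipβ t x) := LinearMap.congr_fun t.comm_μ x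
    rw [Function.comp_apply, Function.comp_apply, ← h, LinearEquiv.symm_apply_apply]
  rw [Nonsingular, h]
  exact (invDual (flipα t)).symm.bijective.comp (ev_bijective.comp (flipβ t).bijective)

end Flip

/-- A flip-isomorphism of the boundary of a non-singular form is determined by an automorphism
`β` and a class `ν` with `θ + λ* ν λ = -β* θ β`. -/
theorem exists_flipIso {X : QForm Λ (-ε)} (hX : X.Nonsingular) (β : X.K ≃ₗ[Λ] X.K)
    (ν : Q Λ (-ε) (Dual Λ X.K))
    (h : X.form + pull X.bilin ν = pull β.toLinearMap (-X.form)) :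
    ∃ t : X.boundary.FlipIso, WeakIso.ν t = ν := by
  have hadj : ∀ x, adj X.bilin x = ((-ε : ℤˣ) : ℤ) • X.bilin x := fun x => Dual.ext fun y => by
    rw [adj_apply, X.bilin_swap y x, star_smul, star_star, star_trivial]
    rcases Int.units_eq_one_or (-ε) with h | h <;> simp [h]
  -- Needed for `λ* = -ελ`, which is thereby bijective as well.
  have hunit : ∀ (u : ℤˣ) (φ : X.K →ₗ[Λ] Dual Λ X.K), (∀ x, φ x = (u : ℤ) • X.bilin x) →
      Function.Bijective φ := by
    intro u φ hφ
    rcases Int.units_eq_one_or u with rfl | rfl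
    · have : ⇑φ = X.bilin := funext fun x => by simp [hφ]
      rw [this]
      exact hX
    · have : ⇑φ = Neg.neg ∘ X.bilin := funext fun x => by simp [hφ]
      rw [this]
      exact neg_involutive.bijective.comp hX
  have hbij : Function.Bijective (adj X.bilin) := hunit (-ε) _ hadj
  -- The equation for `μ` leaves only this choice: `α = β^{-*} λ*`.
  let α : X.K ≃ₗ[Λ] Dual Λ X.K := (LinearEquiv.ofBijective (adj X.bilin) hbij).trans (invDual β)
  have hα : ∀ y x, α y (β x) = star (X.bilin x y) := fun y x => by
    change adj X.bilin y (β.symm (β x)) = _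
    rw [β.symm_apply_apply, adj_apply]
  refine ⟨⟨α, β, ν, ?_, ?_, h⟩, rfl⟩
  -- The equation for `γ`, evaluated at `β y`, is the conjugate of the symmetrization of `h`.
  · refine LinearMap.ext fun (x : X.K) => Dual.ext fun (v : X.K) => ?_
    obtain ⟨y, rfl⟩ := β.surjective v
    have hs := congrArg (symmetrize (-ε)) h
    rw [map_add, symmetrize_pull, symmetrize_pull, map_neg] at hs
    have hs' : X.bilin y x + symmetrize (-ε) ν (X.bilin y) (X.bilin x) =
        -X.bilin (β y) (β x) :=
      congrArg (fun φ : X.K →ₗ[Λ] Dual Λ X.K => φ y x) hs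
    have hσ : ∀ f g : Dual Λ X.K, f (sigma ν g) = symmetrize (-ε) ν f g := fun f g => by
      have h1 : ev (sigma ν g) = adj (symmetrize (-ε) ν) g := evEquiv.apply_symm_apply _
      have h2 := congrArg (fun φ : Dual Λ (Dual Λ X.K) => star (φ f)) h1
      simpa only [ev_apply, adj_apply, star_star] using h2
    change α x (β y) + α (sigma ν (X.bilin x)) (β y) = ((ε : ℤ) • X.bilin (β x)) (β y)
    rw [hα, hα, ← star_add, hσ, hs', X.bilin_swap (β y)]
    rcases Int.units_eq_one_or ε with h | h <;> simp [h]
  · refine LinearMap.ext fun (x : X.K) => Dual.ext fun (f : Dual Λ X.K) => ?_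
    obtain ⟨y, rfl⟩ := α.surjective f
    change X.bilin x (α.symm (α y)) = star (α y (β x))
    rw [α.symm_apply_apply, hα, star_star]

/-- Take `β = 1`. The condition becomes `λ*νλ = -2θ`, solved by pulling `-2θ` back along `λ⁻¹`. -/
theorem nonempty_flipIso {X : QForm Λ (-ε)} (hX : X.Nonsingular) :
    Nonempty X.boundary.FlipIso := by
  let lam : X.K ≃ₗ[Λ] Dual Λ X.K := LinearEquiv.ofBijective X.bilin hX
  have hlam : lam.symm.toLinearMap ∘ₗ X.bilin = LinearMap.id :=
    LinearMap.ext fun x => lam.symm_apply_apply x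
  obtain ⟨t, _⟩ := exists_flipIso hX (LinearEquiv.refl Λ _)
    (pull lam.symm.toLinearMap (-X.form - X.form)) (by
      rw [pull_pull, hlam, pull_id]
      refine Eq.trans ?_ (pull_id (-X.form)).symm
      abel)
  exact ⟨t⟩

/-- With `ν = 0` the condition on `β` reads `θ = β*(-θ)β`. -/
theorem exists_strong_flipIso_iff (X : QForm Λ (-ε)) :
    (∃ t : X.boundary.FlipIso, t.IsStrong) ↔ X.Nonsingular ∧ X.Isometric X.neg := by
  constructor
  · rintro ⟨t, ht⟩
    refine ⟨nonsingular_of_flipIso t, flipβ t, ?_⟩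
    have h := form_add_pull_flipν t
    have ht' : flipν t = 0 := ht
    rw [ht', map_zero, add_zero] at h
    exact h.symm
  · rintro ⟨hX, β, hβ⟩
    refine exists_flipIso hX β 0 ?_
    rw [map_zero, add_zero]
    exact hβ.symm

theorem stableFlipIso_iff (X : QForm Λ (-ε)) : Nonempty X.boundary.StableFlipIso ↔
    X.Nonsingular := by
  constructor
  · rintro ⟨P, t⟩
    rw [boundary_sum_eq] at t
    exact (nonsingular_of_flipIso t).of_sum_left
  · intro hX
    obtain ⟨t⟩ := nonempty_flipIso (hX.sum (nonsingular_hyperbolic (η := -ε) PUnit.{u + 1}))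
    rw [← boundary_sum_eq] at t
    exact ⟨⟨PUnit, t⟩⟩

theorem exists_strong_stableFlipIso_iff (X : QForm Λ (-ε)) :
    (∃ s : X.boundary.StableFlipIso, s.flipIso.IsStrong) ↔
      ∃ (P : Type u) (_ : AddCommGroup P) (_ : Module Λ P) (_ : Module.Free Λ P)
        (_ : Module.Finite Λ P), X.Nonsingular ∧
          (X.sum (hyperbolic Λ (-ε) P)).Isometric (X.sum (hyperbolic Λ (-ε) P)).neg := by
  have key : ∀ (P : Type u) [AddCommGroup P] [Module Λ P] [Module.Free Λ P] [Module.Finite Λ P],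
      (∃ t : (X.boundary.sum (hyperbolic Λ (-ε) P).boundary).FlipIso, t.IsStrong) ↔
        X.Nonsingular ∧
          (X.sum (hyperbolic Λ (-ε) P)).Isometric (X.sum (hyperbolic Λ (-ε) P)).neg := by
    intro P _ _ _ _
    rw [boundary_sum_eq, exists_strong_flipIso_iff]
    exact and_congr_left' ⟨Nonsingular.of_sum_left, fun h => h.sum (nonsingular_hyperbolic P)⟩
  constructor
  · rintro ⟨⟨P, t⟩, ht⟩
    exact ⟨P, inferInstance, inferInstance, inferInstance, inferInstance, (key P).1 ⟨t, ht⟩⟩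
  · rintro ⟨P, _, _, _, _, h⟩
    obtain ⟨t, ht⟩ := (key P).2 h
    exact ⟨⟨P, t⟩, ht⟩

end QForm

/-! ### The Witt group of quadratic forms -/

section WittGroup

open QForm

variable {Λ : Type u} [Ring Λ] [StarRing Λ] {ε η : ℤˣ}

theorem LGroup.mk_eq_zero_iff (X : QForm Λ η) (hX : X.Nonsingular) :
    LGroup.mk X hX = 0 ↔
      ∃ (P : Type u) (_ : AddCommGroup P) (_ : Module Λ P) (_ : Module.Free Λ P)
        (_ : Module.Finite Λ P) (P' : Type u) (_ : AddCommGroup P') (_ : Module Λ P')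
        (_ : Module.Free Λ P') (_ : Module.Finite Λ P'),
        cls X + cls (hyperbolic Λ η P) = cls (hyperbolic Λ η P') := by
  constructor
  · intro h
    obtain ⟨⟨s, hs⟩, ⟨P, _, _, _, _, hP⟩, ⟨t, ht⟩, ⟨P', _, _, _, _, hP'⟩, hst⟩ :=
      (AddCon.eq _).1 (h : LGroup.mk X hX = AddCon.toQuotient (c := stableCon _) 0)
    refine ⟨P, inferInstance, inferInstance, inferInstance, inferInstance, P', inferInstance,
      inferInstance, inferInstance, inferInstance, ?_⟩
    have h1 : cls X + s = 0 + t := congrArg Subtype.val hst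
    rw [zero_add] at h1
    exact (congrArg _ hP).trans (h1.trans hP'.symm)
  · rintro ⟨P, _, _, _, _, P', _, _, _, _, h⟩
    refine (AddCon.eq (c := stableCon _)).2 ?_
    refine ⟨⟨cls (hyperbolic Λ η P), _, nonsingular_hyperbolic P, rfl⟩,
      ⟨P, inferInstance, inferInstance, inferInstance, inferInstance, rfl⟩,
      ⟨cls (hyperbolic Λ η P'), _, nonsingular_hyperbolic P', rfl⟩,
      ⟨P', inferInstance, inferInstance, inferInstance, inferInstance, rfl⟩, Subtype.ext ?_⟩
    exact h.trans (zero_add _).symm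

theorem LGroup.mk_sum {X Y : QForm Λ η} (hX : X.Nonsingular) (hY : Y.Nonsingular) :
    LGroup.mk (X.sum Y) (hX.sum hY) = LGroup.mk X hX + LGroup.mk Y hY := rfl

theorem LGroup.mk_congr {X Y : QForm Λ η} (hX : X.Nonsingular) (hY : Y.Nonsingular)
    (h : X.Isometric Y) : LGroup.mk X hX = LGroup.mk Y hY := by
  have e : cls X = cls Y := Quotient.sound h
  refine congrArg (AddCon.toQuotient (c := stableCon _)) (Subtype.ext e)

theorem LGroup.mk_hyperbolic (P : Type u) [AddCommGroup P] [Module Λ P] [Module.Free Λ P]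
    [Module.Finite Λ P] :
    LGroup.mk (hyperbolic Λ η P) (nonsingular_hyperbolic P) = 0 := by
  refine (LGroup.mk_eq_zero_iff _ _).2 ⟨P, inferInstance, inferInstance, inferInstance,
    inferInstance, P × P, inferInstance, inferInstance, inferInstance, inferInstance, ?_⟩
  exact Quotient.sound (hyperbolic_sum P P)

theorem LGroup.mk_add_neg {X : QForm Λ η} (hX : X.Nonsingular) :
    LGroup.mk X hX + LGroup.mk X.neg hX.neg = 0 := by
  rw [← LGroup.mk_sum, ← LGroup.mk_congr (nonsingular_hyperbolic X.K) (hX.sum hX.neg)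
    (hyperbolic_isometric_sum_neg X hX)]
  exact LGroup.mk_hyperbolic X.K

/-- A nontrivial stably finite ring has invariant basis number, so ranks can be compared: `2 rk K +
2 rk P = 2 rk P'`. Over the zero ring all modules vanish. -/
theorem nonempty_linearEquiv_of_hyperbolic [IsStablyFiniteRing Λ] {X : QForm Λ η}
    {P P' : Type u} [AddCommGroup P] [Module Λ P] [Module.Free Λ P] [Module.Finite Λ P]
    [AddCommGroup P'] [Module Λ P'] [Module.Free Λ P'] [Module.Finite Λ P']
    (h : cls (X.sum X) + cls (hyperbolic Λ η P) = cls (hyperbolic Λ η P')) :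
    Nonempty ((X.K × P) ≃ₗ[Λ] P') := by
  rcases subsingleton_or_nontrivial Λ with hΛ | hΛ
  · have : Subsingleton (X.K × P) := Module.subsingleton Λ _
    have : Subsingleton P' := Module.subsingleton Λ _
    exact ⟨0⟩
  · obtain ⟨⟨f, -⟩⟩ : Nonempty {f : ((X.K × X.K) × (P × Dual Λ P)) ≃ₗ[Λ] P' × Dual Λ P' // True} := by
      obtain ⟨f, _⟩ := Quotient.exact h
      exact ⟨⟨f, trivial⟩⟩
    let b := Module.Free.chooseBasis Λ X.K
    let c := Module.Free.chooseBasis Λ P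
    let d := Module.Free.chooseBasis Λ P'
    let c' : Module.Basis _ Λ (Dual Λ P) := Module.Basis.ofEquivFun (dualBasisEquiv c)
    let d' : Module.Basis _ Λ (Dual Λ P') := Module.Basis.ofEquivFun (dualBasisEquiv d)
    let e₁ := ((b.prod b).prod (c.prod c')).equivFun
    let e₂ := (d.prod d').equivFun
    have h1 := card_eq_of_linearEquiv Λ ((e₁.symm.trans f).trans e₂)
    simp only [Fintype.card_sum] at h1
    have h2 : Fintype.card (Module.Free.ChooseBasisIndex Λ X.K ⊕ Module.Free.ChooseBasisIndex Λ P) =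
        Fintype.card (Module.Free.ChooseBasisIndex Λ P') := by
      rw [Fintype.card_sum]
      omega
    exact ⟨(b.prod c).equiv d (Fintype.equivOfCardEq h2)⟩

/-- From `X ⊕ X ⊕ H(P) ≅ H(P')` the rank comparison gives `H(P') ≅ H(K) ⊕ H(P) ≅ X ⊕ -X ⊕ H(P)`.
Hence `X ⊕ H(P') ≅ -X ⊕ X ⊕ X ⊕ H(P) ≅ -X ⊕ H(P')`, and hyperbolic forms equal their negatives.
Conversely such an isometry gives `[X] = -[X]`. -/
theorem LGroup.two_nsmul_mk_eq_zero_iff [IsStablyFiniteRing Λ] (X : QForm Λ η)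
    (hX : X.Nonsingular) : 2 • LGroup.mk X hX = 0 ↔
      ∃ (P : Type u) (_ : AddCommGroup P) (_ : Module Λ P) (_ : Module.Free Λ P)
        (_ : Module.Finite Λ P),
          (X.sum (hyperbolic Λ η P)).Isometric (X.sum (hyperbolic Λ η P)).neg := by
  have h2 : 2 • LGroup.mk X hX = LGroup.mk (X.sum X) (hX.sum hX) := two_nsmul _
  constructor
  · intro h
    rw [h2, LGroup.mk_eq_zero_iff] at h
    obtain ⟨P, _, _, _, _, P', _, _, _, _, h⟩ := h
    obtain ⟨e⟩ := nonempty_linearEquiv_of_hyperbolic h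
    refine ⟨P', inferInstance, inferInstance, inferInstance, inferInstance, ?_⟩
    suffices e : cls (X.sum (hyperbolic Λ η P')) = cls (X.sum (hyperbolic Λ η P')).neg from
      Quotient.exact e
    have e1 : cls (hyperbolic Λ η X.K) + cls (hyperbolic Λ η P) = cls (hyperbolic Λ η P') :=
      Quotient.sound ((hyperbolic_sum X.K P).trans (hyperbolic_congr e))
    have e2 : cls (hyperbolic Λ η X.K) = cls X + cls X.neg :=
      Quotient.sound (hyperbolic_isometric_sum_neg X hX)
    have e3 : cls (X.sum (hyperbolic Λ η P')).neg = cls X.neg + cls (hyperbolic Λ η P') := by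
      rw [← neg_sum]
      exact Quotient.sound (sum_congr (Isometric.refl _) (neg_hyperbolic_isometric P'))
    have e4 : cls (X.sum (hyperbolic Λ η P')) = cls X + cls (hyperbolic Λ η P') := rfl
    have e5 : cls (X.sum X) = cls X + cls X := rfl
    calc cls (X.sum (hyperbolic Λ η P'))
        = cls X + (cls X + cls X.neg + cls (hyperbolic Λ η P)) := by rw [e4, ← e1, e2]
      _ = cls X.neg + (cls X + cls X + cls (hyperbolic Λ η P)) := by abel
      _ = cls (X.sum (hyperbolic Λ η P')).neg := by rw [e3, ← h, e5]
  · rintro ⟨P, _, _, _, _, h⟩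
    have hY : (X.sum (hyperbolic Λ η P)).Nonsingular := hX.sum (nonsingular_hyperbolic P)
    have e1 : LGroup.mk (X.sum (hyperbolic Λ η P)) hY = LGroup.mk X hX := by
      rw [LGroup.mk_sum hX (nonsingular_hyperbolic P), LGroup.mk_hyperbolic, add_zero]
    have e2 := LGroup.mk_add_neg hY
    rw [← LGroup.mk_congr hY hY.neg h, e1] at e2
    rw [two_nsmul, e2]

end WittGroup

/-! ### Elementary classes in the `l`-monoid -/

section LMonoidSection

open QForm Preformation

variable {Λ : Type u} [Ring Λ] [StarRing Λ] {ε : ℤˣ}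

/-- Elementariness survives adding `∂H(P)` and strong isomorphism, so an elementary representative
makes some `∂(X ⊕ H(P'))` elementary. Then `X ⊕ H(P')` is itself hyperbolic. -/
theorem LMonoid.mk_isElementary_iff (X : QForm Λ (-ε)) :
    (LMonoid.mk X.boundary).IsElementary ↔
      ∃ hX : X.Nonsingular, LGroup.mk X hX = 0 := by
  constructor
  · rintro ⟨z, hz, h⟩
    obtain ⟨_, ⟨P, _, _, _, _, rfl⟩, _, ⟨P', _, _, _, _, rfl⟩, h⟩ := (AddCon.eq _).1 h
    have h1 : (z.sum (hyperbolic Λ (-ε) P).boundary).StrongIso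
        (X.boundary.sum (hyperbolic Λ (-ε) P').boundary) := Quotient.exact h
    have h2 := (hz.sum (isElementary_boundary_hyperbolic P)).congr h1
    rw [boundary_sum_eq] at h2
    obtain ⟨W, _, _, _, _, hW⟩ := exists_isometric_hyperbolic _ h2
    have hX : X.Nonsingular := ((nonsingular_hyperbolic W).congr hW).of_sum_left
    refine ⟨hX, (LGroup.mk_eq_zero_iff X hX).2 ⟨P', inferInstance, inferInstance, inferInstance,
      inferInstance, W, inferInstance, inferInstance, inferInstance, inferInstance, ?_⟩⟩
    exact Quotient.sound hW.symm
  · rintro ⟨hX, h⟩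
    obtain ⟨P, _, _, _, _, P', _, _, _, _, h⟩ := (LGroup.mk_eq_zero_iff X hX).1 h
    have h1 : (X.sum (hyperbolic Λ (-ε) P)).Isometric (hyperbolic Λ (-ε) P') := Quotient.exact h
    have h2 := boundary_congr h1
    rw [← boundary_sum_eq] at h2
    refine ⟨(hyperbolic Λ (-ε) P').boundary, isElementary_boundary_hyperbolic P', ?_⟩
    refine (AddCon.eq (c := stableCon _)).2 ⟨0, AddSubmonoid.zero_mem _,
      (hyperbolic Λ (-ε) P).boundary.cls,
      ⟨P, inferInstance, inferInstance, inferInstance, inferInstance, rfl⟩, ?_⟩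
    rw [add_zero]
    exact Quotient.sound h2.symm

theorem LMonoid.isElementary_of_isElementary {z : Preformation Λ ε} (h : z.IsElementary) :
    (LMonoid.mk z).IsElementary := ⟨z, h, rfl⟩

end LMonoidSection

/-! ### The asymmetric Witt group -/

section AsymmetricWitt

variable {Λ : Type u} [Ring Λ] [StarRing Λ] {ε η : ℤˣ}

theorem LAsy.mk_sum (A B : AsymForm Λ) : LAsy.mk (A.sum B) = LAsy.mk A + LAsy.mk B := rfl

theorem LAsy.mk_congr {A B : AsymForm Λ} (h : A.Isometric B) : LAsy.mk A = LAsy.mk B := by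
  have e : A.cls = B.cls := Quotient.sound h
  exact congrArg (AddCon.toQuotient (c := stableCon _)) e

theorem LAsy.mk_eq_zero_of_isMetabolic {A : AsymForm Λ} (h : A.IsMetabolic) : LAsy.mk A = 0 := by
  refine (AddCon.eq (c := stableCon _)).2 ⟨0, AddSubmonoid.zero_mem _, A.cls, ⟨A, h, rfl⟩, ?_⟩
  rw [add_zero, zero_add]

/-- The definition only gives an isometry of `A ⊕ N` with a metabolic form; a lagrangian is pulled
back along it. -/
theorem LAsy.exists_isMetabolic_of_mk_eq_zero {A : AsymForm Λ} (h : LAsy.mk A = 0) :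
    ∃ N : AsymForm Λ, N.IsMetabolic ∧ (A.sum N).IsMetabolic := by
  obtain ⟨_, ⟨N, hN, rfl⟩, _, ⟨N', ⟨L, ⟨C, hC⟩, hL⟩, rfl⟩, h⟩ :=
    (AddCon.eq _).1 (h : LAsy.mk A = AddCon.toQuotient (c := stableCon _) 0)
  rw [zero_add] at h
  have h' : (A.sum N).Isometric N' := Quotient.exact h
  obtain ⟨f, hf⟩ := h'
  refine ⟨N, hN, L.comap f.toLinearMap, ⟨C.comap f.toLinearMap, ?_⟩, fun x => ?_⟩
  · exact hC.map (Submodule.orderIsoMapComap f).symm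
  · refine (hL (f x)).trans ⟨fun h y hy => ?_, fun h y hy => ?_⟩
    · rw [← hf]
      exact h _ hy
    · obtain ⟨v, rfl⟩ := f.surjective y
      rw [hf]
      exact h v hy

theorem LAsy.mk_eq_of_sum_neg_isMetabolic {A B : AsymForm Λ} (h : (A.sum B.neg).IsMetabolic) :
    LAsy.mk A = LAsy.mk B := by
  have h1 : LAsy.mk A + LAsy.mk B.neg = 0 := LAsy.mk_eq_zero_of_isMetabolic h
  have h2 : LAsy.mk B + LAsy.mk B.neg = 0 :=
    LAsy.mk_eq_zero_of_isMetabolic B.sum_neg_isMetabolic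
  exact add_right_cancel (h1.trans h2.symm)

end AsymmetricWitt

/-! ### Asymmetric signatures of flip-isomorphisms of boundaries -/

namespace QForm

open Preformation

variable {Λ : Type u} [Ring Λ] [StarRing Λ] {ε η : ℤˣ}

theorem asymForm_sum {X Y : QForm Λ η} (hX : X.Nonsingular) (hY : Y.Nonsingular) :
    ((X.sum Y).asymForm (hX.sum hY)).Isometric ((X.asymForm hX).sum (Y.asymForm hY)) :=
  ⟨LinearEquiv.refl Λ (X.K × Y.K), fun x y =>
    (congrArg (fun φ : X.K × Y.K →ₗ[Λ] Dual Λ (X.K × Y.K) => φ x y) (bilin_sum X Y)).symm⟩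

theorem asymForm_congr {X Y : QForm Λ η} (hX : X.Nonsingular) (hY : Y.Nonsingular)
    (h : X.Isometric Y) : (X.asymForm hX).Isometric (Y.asymForm hY) := by
  obtain ⟨f, hf⟩ := h
  have h : X.bilin = pullHom f.toLinearMap Y.bilin := by
    rw [bilin, ← hf]
    exact symmetrize_pull _ _
  exact ⟨f, fun x y => (congrArg (fun φ : X.K →ₗ[Λ] Dual Λ X.K => φ x y) h).symm⟩

theorem asymForm_hyperbolic_isMetabolic (P : Type u) [AddCommGroup P] [Module Λ P]
    [Module.Free Λ P] [Module.Finite Λ P] :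
    ((hyperbolic Λ η P).asymForm (nonsingular_hyperbolic P)).IsMetabolic := by
  refine ⟨LinearMap.range (LinearMap.inl Λ P (Dual Λ P)),
    ⟨LinearMap.range (LinearMap.inr Λ P (Dual Λ P)), LinearMap.isCompl_range_inl_inr⟩, ?_⟩
  rintro ⟨(p : P), (f : Dual Λ P)⟩
  have e : ∀ y : P, (hyperbolic Λ η P).bilin (p, f) (y, (0 : Dual Λ P)) = f y := fun y => by
    refine (bilin_hyperbolic P (p, f) (y, 0)).trans ?_
    change f y + (η : ℤ) • star (0 : Λ) = f y
    rw [star_zero, smul_zero, add_zero]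
  constructor
  · rintro ⟨w, hw⟩ _ ⟨y, rfl⟩
    have hf : (0 : Dual Λ P) = f := congrArg Prod.snd hw
    refine (e y).trans ?_
    rw [← hf, Dual.zero_apply]
  · intro h
    have hf : f = 0 := Dual.ext fun y => (e y).symm.trans (h _ ⟨y, rfl⟩)
    exact ⟨p, Prod.ext rfl hf.symm⟩

theorem mk_asymForm_sum_hyperbolic {X : QForm Λ η} (hX : X.Nonsingular) (P : Type u)
    [AddCommGroup P] [Module Λ P] [Module.Free Λ P] [Module.Finite Λ P] :
    LAsy.mk ((X.sum (hyperbolic Λ η P)).asymForm (hX.sum (nonsingular_hyperbolic P))) =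
      LAsy.mk (X.asymForm hX) := by
  rw [LAsy.mk_congr (asymForm_sum hX (nonsingular_hyperbolic P)), LAsy.mk_sum,
    LAsy.mk_eq_zero_of_isMetabolic (asymForm_hyperbolic_isMetabolic P), add_zero]

theorem mk_asymForm_eq_zero {X : QForm Λ η} (hX : X.Nonsingular) (h : LGroup.mk X hX = 0) :
    LAsy.mk (X.asymForm hX) = 0 := by
  obtain ⟨P, _, _, _, _, P', _, _, _, _, h⟩ := (LGroup.mk_eq_zero_iff X hX).1 h
  have h1 : (X.sum (hyperbolic Λ η P)).Isometric (hyperbolic Λ η P') := Quotient.exact h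
  rw [← mk_asymForm_sum_hyperbolic hX P,
    LAsy.mk_congr (asymForm_congr _ (nonsingular_hyperbolic P') h1),
    LAsy.mk_eq_zero_of_isMetabolic (asymForm_hyperbolic_isMetabolic P')]

/-- The asymmetric signature of a flip-isomorphism of `∂(K, θ)` is the class of
`(K, θ - ε θ*)`. -/
theorem asymSignature_eq {X : QForm Λ (-ε)} (hX : X.Nonsingular) (t : X.boundary.FlipIso) :
    FlipIso.asymSignature t = LAsy.mk (X.asymForm hX) := by
  apply LAsy.mk_eq_of_sum_neg_isMetabolic
  let M : Type u := X.K × Dual Λ X.K × X.K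
  let α := flipα t
  let b := (flipβ t).symm
  let rho : M →ₗ[Λ] Dual Λ M := FlipIso.rho t
  have hε : ∀ a : Λ, (ε : ℤ) • (ε : ℤ) • a = a := fun a => by
    rw [smul_smul, coe_unit_mul_self, one_smul]
  have hswap : ∀ x y, star (X.bilin x y) = -((ε : ℤ) • X.bilin y x) := fun x y => by
    rw [X.bilin_swap y x, Units.val_neg, neg_smul, smul_neg, neg_neg, hε]
  -- This and `hσ` express every entry of `rho` through `λ` and `b = β⁻¹` alone; `ν` disappears
  -- through the equation for `γ`.
  have hα : ∀ u v, α u v = -((ε : ℤ) • X.bilin u (b v)) := fun u v => by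
    have h := flipα_flipβ t (b v) u
    rw [hswap] at h
    rw [← h]
    exact congrArg (α u) ((flipβ t).apply_symm_apply v).symm
  have hσ : ∀ w v, ((ε : ℤ) • α (sigma (flipν t) (adj α.toLinearMap w))) v =
      X.bilin w v + X.bilin (b w) (b v) := fun w v => by
    have h1 : adj α.toLinearMap w = X.bilin (b w) := by
      rw [← adj_flipα t (b w)]
      exact congrArg (adj α.toLinearMap) ((flipβ t).apply_symm_apply w).symm
    have h2 := flipα_sigma t (b w)
    rw [show flipβ t (b w) = w from (flipβ t).apply_symm_apply w] at h2
    have h3 := congrArg (fun φ : Dual Λ X.K => (ε : ℤ) • φ v) h2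
    have hz : ∀ (φ : Dual Λ X.K) (y : X.K), ((ε : ℤ) • φ) y = (ε : ℤ) • φ y := fun φ y => by
      rcases Int.units_eq_one_or ε with h | h <;> simp [h]
    rw [h1, hz]
    simp only [Dual.add_apply, smul_add, hz, hε] at h3
    have h4 : (ε : ℤ) • flipα t (b w) v = -X.bilin (b w) (b v) := by
      rw [show flipα t (b w) v = _ from hα (b w) v, smul_neg, hε]
    rw [h4] at h3
    rw [← h3, neg_add_cancel_comm]
  let K₁ : X.K × X.K →ₗ[Λ] X.K := LinearMap.fst Λ X.K X.K
  let W₁ : X.K × X.K →ₗ[Λ] X.K := LinearMap.snd Λ X.K X.K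
  -- The lagrangian `i` consists of the vectors `((x, y, w), k)` with `k`, `w` free, `x = β(k + εw)
  -- + εw` and `y = -λ(εk + bw) b`. Since `x - εw = β(k + εw)`, applying `b` removes `β`, and the
  -- terms of the pairing of two such vectors cancel in pairs.
  let xm : X.K × X.K →ₗ[Λ] X.K :=
    (flipβ t).toLinearMap ∘ₗ (K₁ + (ε : ℤ) • W₁) + (ε : ℤ) • W₁
  let ym : X.K × X.K →ₗ[Λ] Dual Λ X.K :=
    -(dualMap b.toLinearMap ∘ₗ X.bilin ∘ₗ ((ε : ℤ) • K₁ + b.toLinearMap ∘ₗ W₁))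
  let i : X.K × X.K →ₗ[Λ] M × X.K := (xm.prod (ym.prod W₁)).prod K₁
  have hx : ∀ c : X.K × X.K, xm c = flipβ t (c.1 + (ε : ℤ) • c.2) + (ε : ℤ) • c.2 := fun _ => rfl
  have hbx : ∀ c : X.K × X.K, b (xm c) = c.1 + (ε : ℤ) • c.2 + (ε : ℤ) • b c.2 := fun c => by
    rw [hx, map_add, map_zsmul]
    exact congrArg (· + (ε : ℤ) • b c.2) ((flipβ t).symm_apply_apply _)
  have hx' : ∀ c : X.K × X.K, b (xm c - (ε : ℤ) • c.2) = c.1 + (ε : ℤ) • c.2 := fun c => by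
    rw [map_sub, hbx, map_zsmul, add_sub_cancel_right]
  have hy : ∀ c v, ym c v = -X.bilin ((ε : ℤ) • c.1 + b c.2) (b v) := fun _ _ => rfl
  let Φ : M × X.K →ₗ[Λ] Dual Λ (M × X.K) := dualSum rho (-X.bilin)
  have hΦ : ∀ v c, Φ v (i c) = α v.1.2.2 (xm c) + (star (ym c (v.1.1 - (ε : ℤ) • v.1.2.2)) +
      (v.1.2.1 c.2 + ((ε : ℤ) • α (sigma (flipν t) (adj α.toLinearMap v.1.2.2))) c.2)) +
        -X.bilin v.2 c.1 := fun _ _ => rfl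
  have hiso : ∀ c c', Φ (i c) (i c') = 0 := by
    intro c c'
    rw [hΦ]
    change α c.2 (xm c') + (star (ym c' (xm c - (ε : ℤ) • c.2)) +
      (ym c c'.2 + ((ε : ℤ) • α (sigma (flipν t) (adj α.toLinearMap c.2))) c'.2)) +
        -X.bilin c.1 c'.1 = 0
    rw [hσ, hα, hbx, hy, hy, hx', star_neg, hswap]
    rcases Int.units_eq_one_or ε with h | h <;>
    · simp only [h, Units.val_one, Units.val_neg, one_smul, neg_smul, map_add, map_neg,
        Dual.add_apply, Dual.neg_apply]
      abel
  -- The vectors with `w = k = 0` complement the image of `i`, and none but zero is orthogonal to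
  -- it: varying `k` detects `b x` because `λ` is injective, then varying `w` detects `y`. Hence the
  -- isotropic image of `i` is its own orthogonal.
  have hdetect : ∀ (x : X.K) (y : Dual Λ X.K), (∀ c, Φ ((x, y, 0), 0) (i c) = 0) →
      x = 0 ∧ y = 0 := by
    intro x y h
    have e : ∀ c, star (ym c x) + y c.2 = 0 := fun c => by
      have h1 := h c
      rw [hΦ] at h1
      simpa using h1
    have hx0 : b x = 0 := by
      apply hX.1
      refine Dual.ext fun k => ?_
      have h1 := e ((ε : ℤ) • k, 0)
      rw [hy, map_zero, map_zero, add_zero, add_zero, star_neg, hswap, neg_neg] at h1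
      simp only [smul_smul, coe_unit_mul_self, one_smul] at h1
      rw [map_zero, Dual.zero_apply, ← hε (X.bilin (b x) k), h1, smul_zero]
    have hx1 : x = 0 := (LinearEquiv.map_eq_zero_iff b).1 hx0
    refine ⟨hx1, Dual.ext fun w => ?_⟩
    have h1 := e (0, w)
    rwa [hx1, map_zero, star_zero, zero_add] at h1
  have hsplit : ∀ v : M × X.K, v = i (v.2, v.1.2.2) +
      ((v.1.1 - xm (v.2, v.1.2.2), v.1.2.1 - ym (v.2, v.1.2.2), 0), 0) := fun v => by
    refine Prod.ext (Prod.ext ?_ (Prod.ext ?_ ?_)) ?_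
    · exact (add_sub_cancel _ _).symm
    · exact (add_sub_cancel _ _).symm
    · exact (add_zero _).symm
    · exact (add_zero _).symm
  let p : M × X.K →ₗ[Λ] X.K × X.K :=
    (LinearMap.snd Λ M X.K).prod
      (LinearMap.snd Λ _ _ ∘ₗ LinearMap.snd Λ _ _ ∘ₗ LinearMap.fst Λ M X.K)
  suffices h : (∃ C, IsCompl (LinearMap.range i) C) ∧
      ∀ v, v ∈ LinearMap.range i ↔ ∀ u ∈ LinearMap.range i, Φ v u = 0 from
    ⟨LinearMap.range i, h⟩
  refine ⟨exists_isCompl_of_retraction i p rfl, fun v => ⟨?_, fun h => ?_⟩⟩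
  · rintro ⟨c, rfl⟩ _ ⟨c', rfl⟩
    exact hiso c c'
  · rw [hsplit v] at h
    obtain ⟨h1, h2⟩ := hdetect _ _ fun c => by
      have h3 := h (i c) ⟨c, rfl⟩
      rwa [map_add, Dual.add_apply, hiso, zero_add] at h3
    refine ⟨(v.2, v.1.2.2), ?_⟩
    conv_rhs => rw [hsplit v, h1, h2]
    exact (add_zero _).symm

theorem stable_asymSignature_eq {X : QForm Λ (-ε)} (hX : X.Nonsingular)
    (s : X.boundary.StableFlipIso) : s.asymSignature = LAsy.mk (X.asymForm hX) := by
  have key : ∀ (P : Type u) [AddCommGroup P] [Module Λ P] [Module.Free Λ P] [Module.Finite Λ P],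
      ∀ t : (X.boundary.sum (hyperbolic Λ (-ε) P).boundary).FlipIso,
        FlipIso.asymSignature t = LAsy.mk (X.asymForm hX) := by
    intro P _ _ _ _
    rw [boundary_sum_eq, ← mk_asymForm_sum_hyperbolic hX P]
    exact asymSignature_eq _
  exact key s.P s.flipIso

end QForm

/-! ### Rank counts and lagrangians over a principal ideal domain -/

section PrincipalIdealDomain

variable {Λ : Type u} [CommRing Λ] [IsDomain Λ] [IsPrincipalIdealRing Λ] [StarRing Λ]
variable {M N : Type u} [AddCommGroup M] [Module Λ M] [Module.Free Λ M] [Module.Finite Λ M]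
  [AddCommGroup N] [Module Λ N] [Module.Free Λ N] [Module.Finite Λ N]

theorem finrank_dual : Module.finrank Λ (Dual Λ M) = Module.finrank Λ M := by
  rw [(dualBasisEquiv (Module.Free.chooseBasis Λ M)).finrank_eq, Module.finrank_fintype_fun_eq_card,
    Module.finrank_eq_card_chooseBasisIndex]

theorem finrank_range_add_ker (f : M →ₗ[Λ] N) :
    Module.finrank Λ (LinearMap.range f) + Module.finrank Λ (LinearMap.ker f) =
      Module.finrank Λ M := by
  rw [← f.quotKerEquivRange.finrank_eq]
  exact Submodule.finrank_quotient_add_finrank _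

/-- The orthogonal `S^⊥ = {x | Φ x vanishes on S}`. -/
def orth (Φ : M →ₗ[Λ] Dual Λ M) (S : Submodule Λ M) : Submodule Λ M :=
  LinearMap.ker (dualMap S.subtype ∘ₗ Φ)

theorem mem_orth {Φ : M →ₗ[Λ] Dual Λ M} {S : Submodule Λ M} {x : M} :
    x ∈ orth Φ S ↔ ∀ s ∈ S, Φ x s = 0 := by
  constructor
  · intro h s hs
    exact congrArg (fun φ : Dual Λ S => φ ⟨s, hs⟩) (LinearMap.mem_ker.1 h)
  · intro h
    exact LinearMap.mem_ker.2 (Dual.ext fun s => h s s.2)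

/-- `S` need not be a summand, so `M → S*` need not be onto, but its image `R` has full rank: `R`
lies in `S*`, and `S` embeds in `R*` because all functionals on `M` come from `Φ`. -/
theorem finrank_orth_add {Φ : M →ₗ[Λ] Dual Λ M} (hΦ : Function.Surjective Φ)
    (S : Submodule Λ M) :
    Module.finrank Λ (orth Φ S) + Module.finrank Λ S = Module.finrank Λ M := by
  let f : M →ₗ[Λ] Dual Λ S := dualMap S.subtype ∘ₗ Φ
  let R : Submodule Λ (Dual Λ S) := LinearMap.range f
  have h1 : Module.finrank Λ R + Module.finrank Λ (orth Φ S) = Module.finrank Λ M :=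
    finrank_range_add_ker f
  have h2 : Module.finrank Λ R ≤ Module.finrank Λ S :=
    (Submodule.finrank_le R).trans_eq finrank_dual
  let g : S →ₗ[Λ] Dual Λ R := dualMap R.subtype ∘ₗ ev
  have hg : Function.Injective g := by
    rw [injective_iff_map_eq_zero]
    intro s hs
    apply Subtype.ext
    apply (ev_bijective (Λ := Λ) (M := M)).1
    refine Dual.ext fun φ => ?_
    obtain ⟨x, rfl⟩ := hΦ φ
    have h3 := congrArg (fun φ : Dual Λ R => φ ⟨f x, x, rfl⟩) hs
    have h4 : star (Φ x s) = 0 := h3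
    rw [ev_apply, h4, Submodule.coe_zero, map_zero, Dual.zero_apply]
  have h5 : Module.finrank Λ S ≤ Module.finrank Λ R :=
    (LinearMap.finrank_le_finrank_of_injective hg).trans_eq finrank_dual
  omega

/-- If `S ⊆ S'` have equal rank, a multiple of each element of `S'` lies in `S`. -/
theorem exists_smul_mem_of_finrank_le {S S' : Submodule Λ M}
    (hr : Module.finrank Λ S' ≤ Module.finrank Λ S) (hS : S ≤ S') (x : M) (hx : x ∈ S') :
    ∃ a : Λ, a ≠ 0 ∧ a • x ∈ S := by
  let S₀ : Submodule Λ S' := S.comap S'.subtype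
  have e : Module.finrank Λ S₀ = Module.finrank Λ S :=
    (Submodule.comapSubtypeEquivOfLe hS).finrank_eq
  have h1 := Submodule.finrank_quotient_add_finrank S₀
  have h2 : Module.finrank Λ (S' ⧸ S₀) = 0 := by omega
  have h3 := Module.finrank_eq_zero_iff_isTorsion.1 h2
  obtain ⟨a, ha⟩ := @h3 (Submodule.Quotient.mk ⟨x, hx⟩)
  refine ⟨a, nonZeroDivisors.ne_zero a.2, ?_⟩
  exact (Submodule.Quotient.mk_eq_zero S₀).1 ha

/-- Lagrangian reduction. With `J` a lagrangian of `A ⊕ B` and `L` one of `B`, elements of `J` whose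
`B`-component lies in `L` project to an isotropic submodule of `A`. Orthogonality to `J + L` ensures
both conditions. -/
theorem AsymForm.exists_half_rank_isotropic {A B : AsymForm Λ} (hB : B.IsMetabolic)
    (hAB : (A.sum B).IsMetabolic) : ∃ S : Submodule Λ A.M,
      (∀ x ∈ S, ∀ y ∈ S, A.lam x y = 0) ∧
        Module.finrank Λ A.M ≤ 2 * Module.finrank Λ S := by
  obtain ⟨L, -, hL⟩ := hB
  obtain ⟨J, -, hJ⟩ := hAB
  let T : Type u := A.M × B.M
  let Φ : T →ₗ[Λ] Dual Λ T := dualSum A.lam B.lam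
  have hΦ : Function.Bijective Φ := (A.sum B).nonsingular
  let J : Submodule Λ T := J
  have hJ' : J = orth Φ J := Submodule.ext fun x => (hJ x).trans mem_orth.symm
  have hL' : L = orth B.lam L := Submodule.ext fun x => (hL x).trans mem_orth.symm
  let L₀ : Submodule Λ T := L.map (LinearMap.inr Λ A.M B.M)
  have rL : Module.finrank Λ L + Module.finrank Λ L = Module.finrank Λ B.M := by
    conv_lhs => enter [1]; rw [hL']
    exact finrank_orth_add B.nonsingular.2 L
  have rJ : Module.finrank Λ J + Module.finrank Λ J = Module.finrank Λ A.M + Module.finrank Λ B.M := by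
    conv_lhs => enter [1]; rw [hJ']
    exact (finrank_orth_add hΦ.2 J).trans Module.finrank_prod
  have rL₀ : Module.finrank Λ L₀ = Module.finrank Λ L :=
    (Submodule.equivMapOfInjective (LinearMap.inr Λ A.M B.M) LinearMap.inr_injective
      L).finrank_eq.symm
  have rV := finrank_orth_add hΦ.2 (J ⊔ L₀)
  have rT : Module.finrank Λ T = Module.finrank Λ A.M + Module.finrank Λ B.M := Module.finrank_prod
  let V : Submodule Λ T := orth Φ (J ⊔ L₀)
  have hVJ : V ≤ J := by
    intro v hv
    rw [hJ']
    exact mem_orth.2 fun s hs => mem_orth.1 hv s (Submodule.mem_sup_left hs)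
  have hVL : ∀ v ∈ V, v.2 ∈ L := by
    intro v hv
    rw [hL']
    refine mem_orth.2 fun s hs => ?_
    have h : A.lam v.1 0 + B.lam v.2 s = 0 :=
      mem_orth.1 hv (0, s) (Submodule.mem_sup_right ⟨s, hs, rfl⟩)
    rwa [map_zero, zero_add] at h
  have rsup : Module.finrank Λ (J ⊔ L₀ : Submodule Λ T) + Module.finrank Λ (J ⊓ L₀ : Submodule Λ T) =
      Module.finrank Λ J + Module.finrank Λ L₀ := by
    have h := Submodule.rank_sup_add_rank_inf_eq J L₀
    simp only [← Module.finrank_eq_rank] at h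
    exact_mod_cast h
  let f : V →ₗ[Λ] A.M := LinearMap.fst Λ A.M B.M ∘ₗ V.subtype
  have rf := finrank_range_add_ker f
  have hker : ∀ v : LinearMap.ker f, (v : V).1 ∈ J ⊓ L₀ := by
    rintro ⟨⟨v, hv⟩, h⟩
    have h1 : v.1 = 0 := h
    exact ⟨hVJ hv, v.2, hVL v hv, Prod.ext h1.symm rfl⟩
  let g : LinearMap.ker f →ₗ[Λ] (J ⊓ L₀ : Submodule Λ T) :=
    LinearMap.codRestrict _ (V.subtype ∘ₗ (LinearMap.ker f).subtype) hker
  have hg : Function.Injective g := fun v w h =>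
    Subtype.ext (Subtype.ext (congrArg (fun u : (J ⊓ L₀ : Submodule Λ T) => (u : T)) h))
  have rker := LinearMap.finrank_le_finrank_of_injective hg
  have rV' : Module.finrank Λ V + Module.finrank Λ (J ⊔ L₀ : Submodule Λ T) =
    Module.finrank Λ T := rV
  -- The rank of `V` is `rk A / 2 + rk (J ∩ L₀)`, and the kernel of the projection `f` embeds in `J
  -- ∩ L₀`.
  refine ⟨LinearMap.range f, ?_, by omega⟩
  rintro _ ⟨⟨v, hv⟩, rfl⟩ _ ⟨⟨w, hw⟩, rfl⟩
  have h1 : A.lam v.1 w.1 + B.lam v.2 w.2 = 0 := (hJ v).1 (hVJ hv) w (hVJ hw)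
  rwa [(hL v.2).1 (hVL v hv) w.2 (hVL w hw), add_zero] at h1

/-- A non-singular `η`-symmetric form which vanishes in the asymmetric Witt group has a
lagrangian. -/
theorem QForm.exists_lagrangian {η : ℤˣ} {X : QForm Λ η} (hX : X.Nonsingular)
    (h : LAsy.mk (X.asymForm hX) = 0) : ∃ L : Submodule Λ X.K,
      (∃ C, IsCompl L C) ∧ ∀ x, x ∈ L ↔ ∀ y ∈ L, X.bilin x y = 0 := by
  obtain ⟨N, hN, hXN⟩ := LAsy.exists_isMetabolic_of_mk_eq_zero h
  obtain ⟨S, hS, hr⟩ := AsymForm.exists_half_rank_isotropic hN hXN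
  let S : Submodule Λ X.K := S
  have hS : ∀ x ∈ S, ∀ y ∈ S, X.bilin x y = 0 := hS
  have hr : Module.finrank Λ X.K ≤ 2 * Module.finrank Λ S := hr
  have h1 := finrank_orth_add hX.2 S
  have hle : S ≤ orth X.bilin S := fun x hx => mem_orth.2 (hS x hx)
  -- `S` has at least half rank, so `S^⊥` has at most the rank of `S` while containing it. Isotropy
  -- then passes from `S` to `S^⊥` by cancelling `a` in the domain.
  have hmul : ∀ x ∈ orth X.bilin S, ∃ a : Λ, a ≠ 0 ∧ a • x ∈ S :=
    exists_smul_mem_of_finrank_le (by omega) hle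
  refine ⟨orth X.bilin S, ?_, fun x => ⟨fun hx y hy => ?_, fun hx => mem_orth.2 fun s hs =>
    hx s (hle hs)⟩⟩
  -- `S^⊥` is the kernel of `K → S*`, whose image is free as a submodule of a free module, so the
  -- map onto the image splits.
  · obtain ⟨s, hs⟩ := LinearMap.exists_rightInverse_of_surjective
      (dualMap S.subtype ∘ₗ X.bilin).rangeRestrict
      (LinearMap.range_rangeRestrict (dualMap S.subtype ∘ₗ X.bilin))
    have hc := (isCompl_range_ker_of_retraction s _ hs).symm
    rw [LinearMap.ker_rangeRestrict] at hc
    exact ⟨_, hc⟩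
  · obtain ⟨a, ha, hay⟩ := hmul y hy
    have h2 := mem_orth.1 hx _ hay
    rw [map_smul, smul_eq_mul] at h2
    exact (mul_eq_zero.1 h2).resolve_left ha

/-- Since `T ψ = -ψ` and `c` is self-conjugate, `ψ = cψ - T(cψ)`. -/
theorem Q.mk_eq_zero_of_half {η : ℤˣ} {c : Λ} (hc : c * 2 = 1) {ψ : M →ₗ[Λ] Dual Λ M}
    (hψ : ψ + T η ψ = 0) : Q.mk η ψ = 0 := by
  have hstar : star c = c := by
    have h : star c * 2 = 1 := by
      have h1 := congrArg star hc
      rwa [star_mul, star_ofNat, star_one, mul_comm] at h1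
    calc star c = star c * (c * 2) := by rw [hc, mul_one]
      _ = c * (star c * 2) := by ring
      _ = c := by rw [h, mul_one]
  rw [← Q.mk_sub_T η (c • ψ)]
  refine congrArg (Q.mk η) (LinearMap.ext fun x => Dual.ext fun y => ?_)
  have h1 : ψ x y + (η : ℤ) • star (ψ y x) = 0 := by
    rw [← T_apply]
    exact congrArg (fun φ : M →ₗ[Λ] Dual Λ M => φ x y) hψ
  have h2 : (η : ℤ) • star (ψ y x) = -ψ x y := (neg_eq_of_add_eq_zero_right h1).symm
  rw [LinearMap.sub_apply, Dual.sub_apply, T_apply, LinearMap.smul_apply, LinearMap.smul_apply,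
    Dual.smul_apply, Dual.smul_apply, hstar, star_mul, hstar, ← mul_smul_comm, h2]
  linear_combination (-ψ x y) * hc

/-- An alternating form is of the shape `φ - φ*`. -/
theorem Q.mk_eq_zero_of_alternating {η : ℤˣ} (hη : η = 1) (h2 : (2 : Λ) ≠ 0)
    (hstar : ∀ a : Λ, star a = a) {ψ : M →ₗ[Λ] Dual Λ M} (hψ : ψ + T η ψ = 0) :
    Q.mk η ψ = 0 := by
  subst hη
  have h1 : ∀ x y, ψ x y + ψ y x = 0 := fun x y => by
    have h := congrArg (fun φ : M →ₗ[Λ] Dual Λ M => φ x y) hψ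
    simpa [T_apply, hstar] using h
  have h0 : ∀ x, ψ x x = 0 := fun x => by
    have h := h1 x x
    rw [← two_mul] at h
    exact (mul_eq_zero.1 h).resolve_left h2
  let b := Module.finBasis Λ M
  -- The strictly upper triangular part of `ψ`. The diagonal of `ψ` is zero, so nothing is lost in
  -- `φ - φ*`.
  let φ : M →ₗ[Λ] Dual Λ M := b.constr ℕ fun i => Dual.of
    (b.constr ℕ fun j => if i < j then ψ (b i) (b j) else 0)
  have hφ : ∀ i j, φ (b i) (b j) = if i < j then ψ (b i) (b j) else 0 := fun i j => by
    simp only [φ, Module.Basis.constr_basis, Dual.of_apply]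
  rw [← Q.mk_sub_T 1 φ]
  refine congrArg (Q.mk 1) (b.ext fun i => ?_)
  refine b.ext (f₁ := (ψ (b i) : M →ₗ[Λ] Λ)) (f₂ := ((φ - T 1 φ) (b i) : Dual Λ M)) fun j => ?_
  change ψ (b i) (b j) = ((φ - T 1 φ) (b i)) (b j)
  rw [LinearMap.sub_apply, Dual.sub_apply, T_apply, hφ, hφ, hstar, Units.val_one, one_smul]
  rcases lt_trichotomy i j with h | rfl | h
  · rw [if_pos h, if_neg h.asymm, sub_zero]
  · rw [if_neg (lt_irrefl i), h0, sub_zero]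
  · rw [if_neg h.asymm, if_pos h, zero_sub]
    exact eq_neg_of_add_eq_zero_left (h1 _ _)

end PrincipalIdealDomain

/-! ### From lagrangians to h-lagrangians -/

namespace QForm

open Preformation

/-- A functional vanishing on `L` is `λ x` for some `x`, and then `x` lies in `L^⊥ = L`; so `λ` maps
`L` onto its annihilator. -/
theorem isElementary_of_lagrangian {Λ : Type u} [Ring Λ] [StarRing Λ] {ε : ℤˣ}
    {X : QForm Λ (-ε)} (hX : X.Nonsingular) {L : Submodule Λ X.K} [Module.Free Λ L]
    [Module.Finite Λ L] {C : Submodule Λ X.K} (hC : IsCompl L C)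
    (hL : ∀ x, x ∈ L ↔ ∀ y ∈ L, X.bilin x y = 0) (hform : pull L.subtype X.form = 0) :
    X.boundary.IsElementary := by
  obtain ⟨r, hr⟩ := exists_retraction_of_isCompl L.subtype L.subtype_injective
    (by rwa [L.range_subtype] : IsCompl (LinearMap.range L.subtype) C)
  let lam : X.K ≃ₗ[Λ] Dual Λ X.K := LinearEquiv.ofBijective X.bilin hX
  refine IsHLagrangianMap.isElementary (z := X.boundary) (j := L.subtype)
    ⟨fun x y => (hL x).1 x.2 y y.2, hform, ⟨r, hr⟩, ⟨r ∘ₗ lam.symm.toLinearMap, ?_⟩, ?_⟩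
  · refine LinearMap.ext fun x => ?_
    have h : r (lam.symm (lam (x : X.K))) = x := by
      rw [lam.symm_apply_apply]
      exact LinearMap.congr_fun hr x
    exact h
  · intro f hf
    obtain ⟨x, hx⟩ : ∃ x, X.bilin x = f := hX.2 f
    have hxL : x ∈ L := (hL x).2 fun y hy => by
      rw [hx]
      exact hf ⟨y, hy⟩
    exact ⟨⟨x, hxL⟩, hx⟩

theorem isElementary_of_mk_asymForm_eq_zero {Λ : Type u} [CommRing Λ] [IsDomain Λ]
    [IsPrincipalIdealRing Λ] [StarRing Λ] {ε : ℤˣ} {X : QForm Λ (-ε)} (hX : X.Nonsingular)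
    (h : LAsy.mk (X.asymForm hX) = 0)
    (hΛ : (∃ c : Λ, c * 2 = 1) ∨ (-ε = 1 ∧ (2 : Λ) ≠ 0 ∧ ∀ a : Λ, star a = a)) :
    X.boundary.IsElementary := by
  obtain ⟨L, ⟨C, hC⟩, hL⟩ := exists_lagrangian hX h
  refine isElementary_of_lagrangian hX hC hL ?_
  obtain ⟨ψ, hψ⟩ := Q.exists_mk (pull L.subtype X.form)
  have hs : ψ + T (-ε) ψ = 0 := by
    rw [← symmetrize_mk, hψ, symmetrize_pull]
    exact LinearMap.ext fun x => Dual.ext fun y => (hL x).1 x.2 y y.2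
  rw [← hψ]
  rcases hΛ with ⟨c, hc⟩ | ⟨hε, h2, hstar⟩
  · exact Q.mk_eq_zero_of_half hc hs
  · exact Q.mk_eq_zero_of_alternating hε h2 hstar hs

/-- Over a field of characteristic different from `2`, and over the integers for `ε = -1`, the
asymmetric Witt class detects elementariness. -/
theorem isElementary_of_field_or_int {Λ : Type u} [Ring Λ] [StarRing Λ] {ε : ℤˣ}
    (hΛ : (IsField Λ ∧ (2 : Λ) ≠ 0) ∨ (Nonempty (Λ ≃+* ℤ) ∧ ε = -1))
    {X : QForm Λ (-ε)} (hX : X.Nonsingular) (h : LAsy.mk (X.asymForm hX) = 0) :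
    X.boundary.IsElementary := by
  rcases hΛ with ⟨hF, h2⟩ | ⟨⟨e⟩, hε⟩
  · let _ : Field Λ := hF.toField
    obtain ⟨c, hc⟩ := hF.mul_inv_cancel h2
    exact isElementary_of_mk_asymForm_eq_zero hX h (Or.inl ⟨c, (hF.mul_comm c 2).trans hc⟩)
  · have hcomm : ∀ a b : Λ, a * b = b * a := fun a b => e.injective (by
      rw [map_mul, map_mul, mul_comm])
    let _ : CommRing Λ := { (inferInstance : Ring Λ) with mul_comm := hcomm }
    have : IsDomain Λ := e.toMulEquiv.isDomain ℤ
    have : IsPrincipalIdealRing Λ := IsPrincipalIdealRing.of_surjective e.symm e.symm.surjective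
    refine isElementary_of_mk_asymForm_eq_zero hX h (Or.inr ⟨by rw [hε, neg_neg], ?_, ?_⟩)
    · intro h2
      have h3 := congrArg e h2
      rw [map_ofNat, map_zero] at h3
      exact two_ne_zero h3
    · intro a
      -- Every element is an integer multiple of `1`, so the involution is trivial.
      have ha : a = ((e a : ℤ) : Λ) := by
        apply e.injective
        rw [map_intCast, Int.cast_id]
      rw [ha, star_intCast]

end QForm

end LTheory

end

theorem mainTheorem4 (Λ : Type u) [Ring Λ] [StarRing Λ] [IsStablyFiniteRing Λ]
    (q : ℕ) (ε : ℤˣ) (hε : ε = (-1) ^ q) (X : LTheory.QForm Λ (-ε)) :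
    X.boundary.IsNonsingularFormation ∧
    -- flip-isomorphisms and stable flip-isomorphisms
    ((Nonempty X.boundary.FlipIso ↔ X.Nonsingular) ∧
      (Nonempty X.boundary.StableFlipIso ↔ X.Nonsingular)) ∧
    -- stable strong flip-isomorphisms
    ((∃ s : X.boundary.StableFlipIso, s.flipIso.IsStrong) ↔
      ∃ hX : X.Nonsingular, 2 • LTheory.LGroup.mk X hX = 0) ∧
    -- elementariness
    ((LTheory.LMonoid.mk X.boundary).IsElementary ↔
      ∃ hX : X.Nonsingular, LTheory.LGroup.mk X hX = 0) ∧
    -- the asymmetric signatures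
    (∀ hX : X.Nonsingular,
      (∀ t : X.boundary.FlipIso, t.asymSignature = LTheory.LAsy.mk (X.asymForm hX)) ∧
      (∀ s : X.boundary.StableFlipIso, s.asymSignature = LTheory.LAsy.mk (X.asymForm hX))) ∧
    -- fields of characteristic different from 2, and the integers with ε = -1
    ((IsField Λ ∧ (2 : Λ) ≠ 0) ∨ (Nonempty (Λ ≃+* ℤ) ∧ ε = -1) →
      (X.boundary.IsElementary ↔
        Nonempty X.boundary.StableFlipIso ∧
          ∀ s : X.boundary.StableFlipIso, s.asymSignature = 0) ∧
      ((LTheory.LMonoid.mk X.boundary).IsElementary ↔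
        Nonempty X.boundary.StableFlipIso ∧
          ∀ s : X.boundary.StableFlipIso, s.asymSignature = 0)) := by
  have hstrong : (∃ s : X.boundary.StableFlipIso, s.flipIso.IsStrong) ↔
      ∃ hX : X.Nonsingular, 2 • LTheory.LGroup.mk X hX = 0 := by
    rw [LTheory.QForm.exists_strong_stableFlipIso_iff]
    constructor
    · rintro ⟨P, _, _, _, _, hX, h⟩
      exact ⟨hX, (LTheory.LGroup.two_nsmul_mk_eq_zero_iff X hX).2
        ⟨P, inferInstance, inferInstance, inferInstance, inferInstance, h⟩⟩
    · rintro ⟨hX, h⟩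
      obtain ⟨P, _, _, _, _, h⟩ := (LTheory.LGroup.two_nsmul_mk_eq_zero_iff X hX).1 h
      exact ⟨P, inferInstance, inferInstance, inferInstance, inferInstance, hX, h⟩
  refine ⟨X.boundary_isNonsingularFormation,
    ⟨⟨fun ⟨t⟩ => LTheory.QForm.nonsingular_of_flipIso t, LTheory.QForm.nonempty_flipIso⟩,
      X.stableFlipIso_iff⟩, hstrong, LTheory.LMonoid.mk_isElementary_iff X, fun hX =>
    ⟨LTheory.QForm.asymSignature_eq hX, LTheory.QForm.stable_asymSignature_eq hX⟩, fun hΛ => ?_⟩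
  -- The three conditions form a cycle: vanishing signature gives `z` elementary, hence `[z]`
  -- elementary, hence `[(K,θ)] = 0` and vanishing signature.
  have hback : (Nonempty X.boundary.StableFlipIso ∧
      ∀ s : X.boundary.StableFlipIso, s.asymSignature = 0) → X.boundary.IsElementary := by
    rintro ⟨⟨s⟩, h⟩
    have hX : X.Nonsingular := X.stableFlipIso_iff.1 ⟨s⟩
    exact LTheory.QForm.isElementary_of_field_or_int hΛ hX
      ((LTheory.QForm.stable_asymSignature_eq hX s).symm.trans (h s))
  have hforth : (LTheory.LMonoid.mk X.boundary).IsElementary →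
      Nonempty X.boundary.StableFlipIso ∧
        ∀ s : X.boundary.StableFlipIso, s.asymSignature = 0 := by
    intro h
    obtain ⟨hX, h0⟩ := (LTheory.LMonoid.mk_isElementary_iff X).1 h
    exact ⟨X.stableFlipIso_iff.2 hX, fun s =>
      (LTheory.QForm.stable_asymSignature_eq hX s).trans (LTheory.QForm.mk_asymForm_eq_zero hX h0)⟩
  exact ⟨⟨fun h => hforth (LTheory.LMonoid.isElementary_of_isElementary h), hback⟩,
    ⟨hforth, fun h => LTheory.LMonoid.isElementary_of_isElementary (hback h)⟩⟩
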